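/- Let $d>4$, let $F_d$ be the free group on $d$ generators and let $\mu_d$ be the uniform probability measure on the $2d$ free generators and their inverses. Let $\zeta_1,\zeta_2,\dots$ be i.i.d. with law $\mu_d$, let $X_n=\zeta_1\cdots\zeta_n$ for $n\ge 1$, and let $\mathcal S_n$ be the subsemigroup of $F_d$ generated by $\{X_n,X_{n+1},\dots\}$. Call $(F_d,\mu_d)$ algebraically recurrent (AR) if for every $n\ge 1$, almost surely $\mathcal S_n=F_d$. Then: 1. $(F_d,\mu_d)$ is not AR. 2. More precisely, there is $n_0\ge 1$ such that with positive probability $\mathcal S_{n_0}\subseteq A\ne F_d$, where $A$ is the following (random) set. For $x\in F_d$ let $|x|$ be its reduced length and, for $1\le i\le j\le |x|$, let $x(i,j)$ be the string of the $i$-th through $j$-th symbols of the reduced form of $x$. Then $A=\bigcup_r A_r$, where $A_r$ is the set of all $w\in F_d$ with $|w|=r$ whose reduced form is, for some $m\ge 1$, a concatenation $$X_{n_1}(i_1,j_1)\,X_{n_2}(i_2,j_2)\cdots X_{n_m}(i_m,j_m)$$ with $n_k\ge 1$ and $1\le i_k\le j_k\le |X_{n_k}|$ for all $k$, $i_1=1$,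 and $i_k\le\log_2 j_{k-1}$ for all $2\le k\le m$. -/

import Mathlib

open MeasureTheory ProbabilityTheory

namespace AlgRec

/-- The position `X_n = ζ_1 ζ_2 ⋯ ζ_n` of the walk with the increments `ζ_1, ζ_2, …`; the increment
`ζ_i` is stored as `ζ (i - 1)`, and `X_0 = 1`. -/
def walk {G : Type*} [Group G] (ζ : ℕ → G) : ℕ → G
  | 0 => 1
  | n + 1 => walk ζ n * ζ n

/-- The law of the sequence of increments: the coordinates are i.i.d. with law `μ`. (Here `μ` is
meant to be a probability measure.) -/
noncomputable def incrementLaw {G : Type*} [MeasurableSpace G] (μ : Measure G) :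
    Measure (ℕ → G) :=
  Measure.infinitePi fun _ : ℕ => μ

/-- The semigroup `S_n` generated by `{X_n, X_{n+1}, …}`. -/
def tailSemigroup {G : Type*} [Group G] (X : ℕ → G) (n : ℕ) : Subsemigroup G :=
  Subsemigroup.closure {g | ∃ k, n ≤ k ∧ g = X k}

/-- `(G, μ)` is algebraically recurrent: for every `n ≥ 1`, almost surely `S_n = G`. -/
def IsAR {G : Type*} [Group G] [MeasurableSpace G] (μ : Measure G) : Prop :=
  ∀ n : ℕ, 1 ≤ n → ∀ᵐ ζ ∂(incrementLaw μ), (tailSemigroup (walk ζ) n : Set G) = Set.univ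

/-- A free group is considered with its discrete `σ`-algebra. -/
instance instMeasurableSpaceFreeGroup {α : Type*} : MeasurableSpace (FreeGroup α) := ⊤

instance instDiscreteMeasurableSpaceFreeGroup {α : Type*} :
    DiscreteMeasurableSpace (FreeGroup α) := ⟨fun _ => trivial⟩

/-- The standard symmetric generating set of `F_d`: the free generators and their inverses. -/
def standardGenerators (d : ℕ) : Set (FreeGroup (Fin d)) :=
  {g | ∃ a : Fin d, g = FreeGroup.of a ∨ g = (FreeGroup.of a)⁻¹}

/-- The uniform distribution `μ_d` on the standard symmetric generating set of `F_d`. -/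
noncomputable def stdMeasure (d : ℕ) : Measure (FreeGroup (Fin d)) :=
  uniformOn (standardGenerators d)

/-- `x(i,j)`: the string of the symbols number `i` through `j` (counted from `1`) of the reduced
form of `x`. -/
def symbols {α : Type*} [DecidableEq α] (x : FreeGroup α) (i j : ℕ) : List (α × Bool) :=
  (x.toWord.take j).drop (i - 1)

/-- The set `A_r` attached to a path `X`: the elements `w` of length `r` whose reduced form is a
concatenation `X_{n_0}(i_0,j_0) ⋯ X_{n_m}(i_m,j_m)` of non-empty strings, with `i_0 = 1` and
`i_{k+1} ≤ log₂ j_k`. -/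
def overlapWords {α : Type*} [DecidableEq α] (X : ℕ → FreeGroup α) (r : ℕ) :
    Set (FreeGroup α) :=
  {w | w.norm = r ∧ ∃ (m : ℕ) (n i j : Fin (m + 1) → ℕ),
    (∀ k, 1 ≤ n k ∧ 1 ≤ i k ∧ i k ≤ j k ∧ j k ≤ (X (n k)).norm) ∧
    i 0 = 1 ∧
    (∀ k : Fin m, (i k.succ : ℝ) ≤ Real.logb 2 (j k.castSucc : ℝ)) ∧
    w.toWord = (List.ofFn fun k => symbols (X (n k)) (i k) (j k)).flatten}

/-- The set `A = ⋃ r, A_r`. -/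
def allOverlapWords {α : Type*} [DecidableEq α] (X : ℕ → FreeGroup α) : Set (FreeGroup α) :=
  ⋃ r : ℕ, overlapWords X r

end AlgRec

/-! Restrict to the event that the walk starts with `a ^ M`, for `M` a large power of two. Given
this start, the bad events ruled out by `GoodPath` have total probability below `1`, and on a good
path the inclusion is deterministic. Moreover every `X_n` with non-empty reduced form then begins
with `a`, hence so does every non-trivial word of `A`, and `a⁻¹` is missing from `A`. Part 1 follows
from part 2.

Deterministic half: a non-empty word read along a `Chain` from `1` belongs to `A`, so it suffices
that chain-readability survives right multiplication by `X_n` with `n ≥ M` (`exists_chain_mul`).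
Write `g = w c⁻¹` and `X_n = c t` in reduced form, so that `g X_n = w t`. If the vertex `z` at which
the reading of `w` ends has level at least `2 ^ (|c| + 1)`, a jump into `X_n` at level `|c| + 1`
continues the reading with `t`. Otherwise `c⁻¹` itself has been read from a vertex `z` that is too
low, and this is impossible on a good path. If `c` lies in the prefix `a ^ M`, then `c⁻¹` consists
of letters `a⁻¹`, which do not occur at low levels. If `ℓ = |c|` is large, one of three coincidences
occurs. Most of `c⁻¹` may be read without a jump far out on the path (`FarMatch`), or a sizeable
part may be read at levels comparable with `ℓ` (`NearMatch`). Otherwise the reading jumps twice,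
hence falls to a level logarithmic in `ℓ`, and goes on from there for `ℓ / 100` letters
(`LowMatch`).

Probabilistic half: the law of `X_k` is radial, so each additional letter divides the mass of a cone
by at least `2d - 1 ≥ 9`. Thus a fixed string of length `s` occurs in `X_k` with probability at most
`(k + 1) 9 ^ (-s)` (`measure_infix_le`). The far coincidences cost about `4 ^ ℓ` choices against
more than `0.86 ℓ` letters, the near ones polynomially many against `ℓ / 100` letters. The low ones
involve at most `J ^ 2 * 8 ^ s` strings (`card_chainStrings_le`), and `8 < 9` is where `d > 4` is
decisive. All bounds are summable over `ℓ` and carry the factor `P(start)`, so a large initial scale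
makes their sum as small as desired relative to the start. -/

open scoped ENNReal

namespace AlgRec

/-- The opposite of a letter. -/
def flipLetter {α : Type*} (x : α × Bool) : α × Bool := (x.1, !x.2)

@[simp] theorem flipLetter_flipLetter {α : Type*} (x : α × Bool) : flipLetter (flipLetter x) = x := by
  simp [flipLetter]

/-! ### Reduced words, cancellation, and nearest-neighbour paths in the tree -/

section Words

variable {α : Type*} [DecidableEq α]

open FreeGroup in
/-- The product of two reduced words, with the cancelled part `c` made explicit. -/
theorem reduce_append_decomp (L₁ L₂ : List (α × Bool)) (h₁ : IsReduced L₁) (h₂ : IsReduced L₂) :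
    ∃ w c t, L₁ = w ++ invRev c ∧ L₂ = c ++ t ∧ reduce (L₁ ++ L₂) = w ++ t := by
  induction L₂ generalizing L₁ with
  | nil => exact ⟨L₁, [], [], by simp, by simp, by simpa using h₁.reduce_eq⟩
  | cons a B ih =>
    rcases List.eq_nil_or_concat L₁ with rfl | ⟨A, b, rfl⟩
    · exact ⟨[], [], a :: B, by simp, by simp, by simpa using h₂.reduce_eq⟩
    · rw [List.concat_eq_append] at h₁ ⊢
      by_cases hab : b.1 = a.1 ∧ b.2 = !a.2
      · obtain ⟨w, c, t, hA, hB, hr⟩ := ih A (h₁.infix (List.prefix_append A [b]).isInfix)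
          (h₂.infix (List.suffix_cons a B).isInfix)
        refine ⟨w, a :: c, t, ?_, by simp [hB], ?_⟩
        · rw [hA, invRev_cons]
          have : b = (a.1, !a.2) := Prod.ext hab.1 hab.2
          simp [invRev, this]
        · rw [← hr]
          apply reduce.Step.eq
          have : b = (a.1, !a.2) := Prod.ext hab.1 hab.2
          have h := @Red.Step.not_rev α A B a.1 a.2
          rw [this]
          simpa using h
      · refine ⟨A ++ [b], [], a :: B, by simp, by simp, ?_⟩
        apply IsReduced.reduce_eq
        refine List.IsChain.append h₁ h₂ ?_
        intro x hx y hy hxy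
        simp at hx hy
        subst hx hy
        by_contra hne
        exact hab ⟨hxy, by cases hb : b.2 <;> cases ha : a.2 <;> simp_all⟩

theorem toWord_mul_decomp (x y : FreeGroup α) :
    ∃ w c t, x.toWord = w ++ FreeGroup.invRev c ∧ y.toWord = c ++ t ∧
      (x * y).toWord = w ++ t := by
  obtain ⟨w, c, t, h1, h2, h3⟩ :=
    reduce_append_decomp x.toWord y.toWord FreeGroup.isReduced_toWord FreeGroup.isReduced_toWord
  exact ⟨w, c, t, h1, h2, by rw [FreeGroup.toWord_mul, h3]⟩

theorem toWord_inv_mul_decomp (g h : FreeGroup α) :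
    ∃ c s t, g.toWord = c ++ s ∧ h.toWord = c ++ t ∧
      (g⁻¹ * h).toWord = FreeGroup.invRev s ++ t := by
  obtain ⟨w, c, t, h1, h2, h3⟩ := toWord_mul_decomp g⁻¹ h
  refine ⟨c, FreeGroup.invRev w, t, ?_, h2, by simpa using h3⟩
  rw [FreeGroup.toWord_inv] at h1
  have := congrArg FreeGroup.invRev h1
  simpa using this

/-- At most `|g|` letters of `h` cancel against `g⁻¹`. This transfers a string located late in `X m`
to the increment `(X n)⁻¹ * X m`, which is independent of the first `n` steps. -/
theorem drop_suffix_toWord_inv_mul (g h : FreeGroup α) {k : ℕ} (hk : g.norm ≤ k) :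
    h.toWord.drop k <:+ (g⁻¹ * h).toWord := by
  obtain ⟨c, s, t, h1, h2, h3⟩ := toWord_inv_mul_decomp g h
  have hc : c.length ≤ k := by
    have : g.norm = c.length + s.length := by rw [FreeGroup.norm, h1, List.length_append]
    omega
  rw [h2, h3, List.drop_append, List.drop_eq_nil_of_le hc, List.nil_append]
  exact (List.drop_suffix _ _).trans (List.suffix_append _ _)

theorem toWord_inv_mul_of_prefix {g h : FreeGroup α} {t : List (α × Bool)}
    (ht : h.toWord = g.toWord ++ t) : (g⁻¹ * h).toWord = t := by
  have e : g⁻¹ * h = FreeGroup.mk t := by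
    rw [inv_mul_eq_iff_eq_mul, ← FreeGroup.mk_toWord (x := h), ht, ← FreeGroup.mul_mk,
      FreeGroup.mk_toWord]
  rw [e, FreeGroup.toWord_mk]
  apply FreeGroup.IsReduced.reduce_eq
  have := FreeGroup.isReduced_toWord (x := h)
  rw [ht] at this
  exact this.infix (List.suffix_append _ _).isInfix

theorem mul_letter_cases (g : FreeGroup α) (x : α × Bool) :
    (g * FreeGroup.mk [x]).toWord = g.toWord ++ [x] ∨
      g.toWord = (g * FreeGroup.mk [x]).toWord ++ [flipLetter x] := by
  obtain ⟨w, c, t, h1, h2, h3⟩ := toWord_mul_decomp g (FreeGroup.mk [x])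
  have h2' : [x] = c ++ t := by simpa [FreeGroup.toWord_mk] using h2
  rcases c with _ | ⟨y, c⟩
  · left; rw [h3, h1, ← show t = [x] by simpa using h2'.symm]; simp [FreeGroup.invRev]
  · simp at h2'
    obtain ⟨rfl, rfl, rfl⟩ := h2'
    right; rw [h3, h1]; simp [FreeGroup.invRev, flipLetter]

/-- A path starting at `1` with steps in the standard symmetric generating set. -/
structure IsPath (X : ℕ → FreeGroup α) : Prop where
  zero : X 0 = 1
  step : ∀ n, ∃ x, X (n + 1) = X n * FreeGroup.mk [x]

variable {X : ℕ → FreeGroup α}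

theorem norm_mul_letter_le (g : FreeGroup α) (x : α × Bool) :
    (g * FreeGroup.mk [x]).norm ≤ g.norm + 1 := by
  refine (FreeGroup.norm_mul_le _ _).trans ?_
  have := FreeGroup.norm_mk_le (L₁ := [x])
  simpa using this

theorem IsPath.norm_inv_mul_le (hX : IsPath X) (n k : ℕ) :
    ((X n)⁻¹ * X (n + k)).norm ≤ k := by
  induction k with
  | zero => simp
  | succ k ih =>
    obtain ⟨x, hx⟩ := hX.step (n + k)
    rw [← add_assoc, hx, ← mul_assoc]
    exact (norm_mul_letter_le _ _).trans (by omega)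

theorem IsPath.norm_le (hX : IsPath X) (n : ℕ) : (X n).norm ≤ n := by
  simpa [hX.zero] using hX.norm_inv_mul_le 0 n

/-- The Cayley graph is a tree, so a path from `1` visits every vertex of the geodesic to its
current position. -/
theorem IsPath.exists_of_prefix (hX : IsPath X) {n : ℕ} {p : List (α × Bool)}
    (hp : p <+: (X n).toWord) : ∃ k ≤ n, (X k).toWord = p := by
  induction n with
  | zero =>
    rw [hX.zero, FreeGroup.toWord_one, List.prefix_nil] at hp
    exact ⟨0, le_rfl, by simp [hX.zero, hp]⟩
  | succ n ih =>
    obtain ⟨x, hx⟩ := hX.step n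
    have key : p = (X (n + 1)).toWord ∨ p <+: (X n).toWord := by
      rcases mul_letter_cases (X n) x with h | h
      · rw [← hx] at h
        rw [h] at hp ⊢
        rwa [List.prefix_concat_iff] at hp
      · rw [← hx] at h
        right; rw [h]; exact hp.trans (List.prefix_append _ _)
    rcases key with h | h
    · exact ⟨n + 1, le_rfl, h.symm⟩
    · obtain ⟨k, hk, e⟩ := ih h
      exact ⟨k, by omega, e⟩

end Words

/-! ### Overlapping concatenations as chains of single letters -/

section Chains

variable {α : Type*} [DecidableEq α]

/-- One letter of an overlapping concatenation: from the visited vertex `u` either go on to a child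
or jump to a vertex whose level is at most logarithmic in the level of `u`. -/
def ChainStep (X : ℕ → FreeGroup α) (u : FreeGroup α) (x : α × Bool) (v : FreeGroup α) : Prop :=
  (∃ n, v = X n) ∧ (v.toWord = u.toWord ++ [x] ∨ ∃ p, v.toWord = p ++ [x] ∧ 2 ^ v.norm ≤ u.norm)

/-- `Chain X u w v`: the string `w` can be read along `ChainStep`s from `u` to `v`. -/
inductive Chain (X : ℕ → FreeGroup α) : FreeGroup α → List (α × Bool) → FreeGroup α → Prop
  | nil (u) : Chain X u [] u
  | cons {u x u' w v} : ChainStep X u x u' → Chain X u' w v → Chain X u (x :: w) v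

variable {X : ℕ → FreeGroup α}

theorem Chain.append {u v z : FreeGroup α} {w w' : List (α × Bool)} (h : Chain X u w v)
    (h' : Chain X v w' z) : Chain X u (w ++ w') z := by
  induction h with
  | nil => exact h'
  | cons hs _ ih => exact .cons hs (ih h')

theorem Chain.split {u v : FreeGroup α} {w w' : List (α × Bool)} (h : Chain X u (w ++ w') v) :
    ∃ z, Chain X u w z ∧ Chain X z w' v := by
  induction w generalizing u with
  | nil => exact ⟨u, .nil u, h⟩
  | cons x w ih =>
    cases h with
    | cons hs h =>
      obtain ⟨z, h1, h2⟩ := ih h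
      exact ⟨z, .cons hs h1, h2⟩

theorem Chain.split_last {u v : FreeGroup α} {w : List (α × Bool)} {x : α × Bool}
    (h : Chain X u (w ++ [x]) v) : ∃ z, Chain X u w z ∧ ChainStep X z x v := by
  obtain ⟨z, h1, h2⟩ := h.split
  cases h2 with
  | cons hs h => cases h; exact ⟨z, h1, hs⟩

theorem Chain.visited {u v : FreeGroup α} {w : List (α × Bool)} (h : Chain X u w v)
    (hu : ∃ n, u = X n) : ∃ n, v = X n := by
  induction h with
  | nil => exact hu
  | cons hs _ ih => exact ih hs.1

/-- The maximal initial segment of a chain that is read without a jump. -/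
theorem Chain.run {u v : FreeGroup α} {w : List (α × Bool)} (h : Chain X u w v)
    (hu : ∃ n, u = X n) :
    ∃ w₁ w₂ u₁, w = w₁ ++ w₂ ∧ u₁.toWord = u.toWord ++ w₁ ∧ (∃ n, u₁ = X n) ∧
      (w₂ = [] ∨ ∃ x w₃ u₂ p, w₂ = x :: w₃ ∧ u₂.toWord = p ++ [x] ∧ 2 ^ u₂.norm ≤ u₁.norm ∧
        (∃ n, u₂ = X n) ∧ Chain X u₂ w₃ v) := by
  induction h with
  | nil u => exact ⟨[], [], u, rfl, by simp, hu, .inl rfl⟩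
  | @cons u x u' w v hs hc ih =>
    obtain ⟨hv, h | ⟨p, hp, hle⟩⟩ := hs
    · obtain ⟨w₁, w₂, u₁, e, h1, h2, h3⟩ := ih hv
      exact ⟨x :: w₁, w₂, u₁, by simp [e], by simp [h1, h], h2, h3⟩
    · exact ⟨[], x :: w, u, rfl, by simp, hu, .inr ⟨x, w, u', p, rfl, hp, hle, hv, hc⟩⟩

theorem IsPath.chain_of_prefix (hX : IsPath X) {n : ℕ} {u : FreeGroup α} {t : List (α × Bool)}
    (h : (X n).toWord = u.toWord ++ t) : Chain X u t (X n) := by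
  induction t generalizing u with
  | nil =>
    have : X n = u := FreeGroup.toWord_injective (by simpa using h)
    rw [this]; exact .nil u
  | cons x t ih =>
    obtain ⟨k, -, hk⟩ := hX.exists_of_prefix (n := n) (p := u.toWord ++ [x])
      ⟨t, by simp [h]⟩
    exact .cons ⟨⟨k, rfl⟩, .inl hk⟩ (ih (by simp [h, hk]))

theorem IsPath.chain_of_jump (hX : IsPath X) {n : ℕ} {u : FreeGroup α} {c t : List (α × Bool)}
    (h : (X n).toWord = c ++ t) (ht : t ≠ []) (hu : 2 ^ (c.length + 1) ≤ u.norm) :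
    Chain X u t (X n) := by
  obtain ⟨x, t, rfl⟩ := List.exists_cons_of_ne_nil ht
  obtain ⟨k, -, hk⟩ := hX.exists_of_prefix (n := n) (p := c ++ [x]) ⟨t, by simp [h]⟩
  refine .cons ⟨⟨k, rfl⟩, .inr ⟨c, hk, ?_⟩⟩ (hX.chain_of_prefix (by simp [h, hk]))
  simpa [FreeGroup.norm, hk] using hu

/-- The string attached to a triple `(n, i, j)`. -/
def pieceString (X : ℕ → FreeGroup α) (p : ℕ × ℕ × ℕ) : List (α × Bool) :=
  symbols (X p.1) p.2.1 p.2.2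

/-- A step to a child lengthens the last piece by one symbol, after replacing its path vertex by the
child; a jump to level `i` opens a new piece consisting of the single symbol number `i`. In the last
piece `j` is always the full length of `X n`, which is what makes the lengthening possible. -/
theorem Chain.exists_pieces (hX : IsPath X) {w : List (α × Bool)} {v : FreeGroup α}
    (h : Chain X 1 w v) (hw : w ≠ []) :
    ∃ (qs : List (ℕ × ℕ × ℕ)) (n i : ℕ), X n = v ∧ 1 ≤ i ∧ i ≤ v.norm ∧
      (∀ q ∈ qs, 1 ≤ q.1 ∧ 1 ≤ q.2.1 ∧ q.2.1 ≤ q.2.2 ∧ q.2.2 ≤ (X q.1).norm) ∧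
      (qs ++ [(n, i, v.norm)]).IsChain (fun a b => 2 ^ b.2.1 ≤ a.2.2) ∧
      (∀ q ∈ (qs ++ [(n, i, v.norm)]).head?, q.2.1 = 1) ∧
      w = (qs ++ [(n, i, v.norm)]).flatMap (pieceString X) := by
  have hpos : ∀ n, 1 ≤ (X n).norm → 1 ≤ n := by
    intro n hn
    rcases Nat.eq_zero_or_pos n with rfl | h
    · simp [hX.zero] at hn
    · exact h
  induction w using List.reverseRecOn generalizing v with
  | nil => exact absurd rfl hw
  | append_singleton w x ih =>
    obtain ⟨z, h1, ⟨⟨n, rfl⟩, hs⟩⟩ := h.split_last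
    rcases eq_or_ne w [] with rfl | hne
    · cases h1
      rcases hs with hs | ⟨p, -, hle⟩
      · have hn : (X n).norm = 1 := by simp [FreeGroup.norm, hs]
        refine ⟨[], n, 1, rfl, le_rfl, by omega, by simp, by simp, by simp, ?_⟩
        simp [pieceString, symbols, hn, hs]
      · simp at hle
    · obtain ⟨qs, n', i, rfl, hi, hiv, hq, hch, hhd, hwe⟩ := ih h1 hne
      rcases hs with hs | ⟨p, hp, hle⟩
      · have hn : (X n).norm = (X n').norm + 1 := by simp [FreeGroup.norm, hs]
        refine ⟨qs, n, i, rfl, hi, by omega, hq, ?_, ?_, ?_⟩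
        · rw [List.isChain_append] at hch ⊢
          refine ⟨hch.1, by simp, ?_⟩
          simpa using hch.2.2
        · cases qs with
          | nil => simpa using hhd
          | cons q qs => simpa using hhd
        · rw [hwe, List.flatMap_append, List.flatMap_append, List.append_assoc]
          congr 1
          simp only [pieceString, symbols, List.flatMap_cons, List.flatMap_nil, List.append_nil]
          rw [hs, List.take_of_length_le (by simp [FreeGroup.norm]),
            List.take_of_length_le (by simp [FreeGroup.norm, hs]), List.drop_append]
          have : i - 1 - (X n').toWord.length = 0 := by
            have : (X n').norm = (X n').toWord.length := rfl
            omega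
          simp [this]
      · have hn1 : (X n).norm = p.length + 1 := by simp [FreeGroup.norm, hp]
        refine ⟨qs ++ [(n', i, (X n').norm)], n, (X n).norm, rfl, by omega, le_rfl, ?_, ?_, ?_, ?_⟩
        · intro q hq'
          rcases List.mem_append.1 hq' with h | h
          · exact hq q h
          · simp at h; subst h
            exact ⟨hpos n' (by omega), hi, hiv, le_rfl⟩
        · rw [List.isChain_append]
          refine ⟨hch, by simp, ?_⟩
          simpa using hle
        · cases qs with
          | nil => simpa using hhd
          | cons q qs => simpa using hhd
        · rw [List.flatMap_append, ← hwe]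
          congr 1
          simp only [pieceString, symbols, List.flatMap_cons, List.flatMap_nil, List.append_nil]
          rw [List.take_of_length_le (by simp [FreeGroup.norm]), hn1, hp]
          simp

theorem Chain.mem_allOverlapWords (hX : IsPath X) {g v : FreeGroup α}
    (h : Chain X 1 g.toWord v) (hg : g ≠ 1) : g ∈ allOverlapWords X := by
  obtain ⟨qs, n, i, hnv, hi, hiv, hq, hch, hhd, hw⟩ :=
    h.exists_pieces hX (by simpa [FreeGroup.toWord_eq_nil_iff] using hg)
  refine Set.mem_iUnion.2 ⟨g.norm, rfl, ?_⟩
  set ps := qs ++ [(n, i, v.norm)] with hps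
  have hlen : ps.length = qs.length + 1 := by simp [hps]
  have hall : ∀ q ∈ ps, 1 ≤ q.1 ∧ 1 ≤ q.2.1 ∧ q.2.1 ≤ q.2.2 ∧ q.2.2 ≤ (X q.1).norm := by
    intro q hq'
    rcases List.mem_append.1 hq' with h | h
    · exact hq q h
    · simp at h; subst h
      refine ⟨?_, hi, hiv, by rw [hnv]⟩
      rcases Nat.eq_zero_or_pos n with rfl | h0
      · rw [← hnv, hX.zero] at hiv
        simp at hiv; omega
      · exact h0
  let f : Fin (qs.length + 1) → ℕ × ℕ × ℕ := fun k => ps[k.1]'(by omega)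
  refine ⟨qs.length, fun k => (f k).1, fun k => (f k).2.1, fun k => (f k).2.2,
    fun k => hall _ (List.getElem_mem _), ?_, ?_, ?_⟩
  · apply hhd
    rw [List.head?_eq_getElem?, List.getElem?_eq_getElem (by omega)]
    rfl
  · intro k
    have h2 := (List.isChain_iff_getElem.1 hch) k.1 (by omega)
    have h1 := hall (f k.castSucc) (List.getElem_mem _)
    have h0 : (0 : ℝ) < ((f k.castSucc).2.2 : ℝ) := by exact_mod_cast (by omega)
    rw [Real.le_logb_iff_rpow_le (by norm_num) h0, Real.rpow_natCast]
    exact_mod_cast h2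
  · rw [hw, List.flatMap_def]
    congr 1
    apply List.ext_getElem
    · simp [hlen]
    · intro k h1 h2
      simp [-List.ofFn_succ, f, pieceString]

end Chains

/-! ### Coincidences of strings and good paths -/

section Matches

variable {α : Type*} [DecidableEq α]

open FreeGroup (invRev)

theorem invRev_infix {β : Type*} {S T : List (β × Bool)} (h : S <:+: T) : invRev S <:+: invRev T := by
  obtain ⟨p, q, rfl⟩ := h
  exact ⟨invRev q, invRev p, by simp⟩

theorem mem_invRev {β : Type*} {S : List (β × Bool)} {x : β × Bool} (h : x ∈ invRev S) :
    flipLetter x ∈ S := by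
  simp only [invRev, List.mem_reverse, List.mem_map] at h
  obtain ⟨y, hy, rfl⟩ := h
  simpa [flipLetter] using hy

theorem infix_of_append_eq {β : Type*} {x y z S q : List β} (h : x ++ y = z ++ S ++ q)
    (hl : x.length ≤ z.length) : S <:+: y := by
  have := congrArg (List.drop x.length) h
  rw [List.drop_left, List.append_assoc, List.drop_append_of_le_length hl] at this
  exact ⟨z.drop x.length, q, by rw [this]; simp⟩

/-- The strings of length `s` that can be read along a chain starting with a jump from level `J`
(all other members of this set are irrelevant). -/
def chainStrings (X : ℕ → FreeGroup α) : ℕ → ℕ → Finset (List (α × Bool))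
  | 0, _ => {[]}
  | s + 1, J => (Finset.Icc 1 (Nat.log 2 J)).biUnion fun i =>
      (Finset.univ : Finset (Fin (s + 1))).biUnion fun n =>
        (Finset.range (4 * (i + n) + 1)).biUnion fun t =>
          (chainStrings X (s - n) (i + n)).image fun r => (X t).toWord.drop (i - 1) ++ r
termination_by s => s

/-- A long string of `(X n)⁻¹ * X m` that is inverse to a string of a vertex on level `ℓ`. -/
def FarMatch (X : ℕ → FreeGroup α) (ℓ n : ℕ) : Prop :=
  ∃ m, n ≤ m ∧ m ≤ 2 ^ (ℓ + 4) ∧ ∃ k ≤ 4 * ℓ, k ≤ n ∧ (X k).norm = ℓ ∧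
    invRev ((X k).toWord.drop (14 * (ℓ / 100))) <:+: ((X n)⁻¹ * X m).toWord

/-- A string of `(X n)⁻¹ * X m` that is inverse to a string of an earlier `X k`. -/
def NearMatch (X : ℕ → FreeGroup α) (M ℓ : ℕ) : Prop :=
  ∃ n m, M ≤ n ∧ n ≤ m ∧ m ≤ 20 * ℓ ∧ ∃ k ≤ n, ∃ S, S.length = ℓ / 100 ∧
    invRev S <:+: (X k).toWord ∧ S <:+: ((X n)⁻¹ * X m).toWord

/-- A string of `(X n)⁻¹ * X m` that is inverse to a string read along a chain of low level. -/
def LowMatch (X : ℕ → FreeGroup α) (ℓ n : ℕ) : Prop :=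
  ∃ m, n ≤ m ∧ m ≤ 4 * ℓ ∧ ∃ S ∈ chainStrings X (ℓ / 100) (2 * ℓ), S.length = ℓ / 100 ∧
    invRev S <:+: ((X n)⁻¹ * X m).toWord

/-- A path that starts with `a ^ M`, never backtracks into this prefix, escapes linearly and has
no coincidences on large scales. -/
structure GoodPath (X : ℕ → FreeGroup α) (a : α) (M : ℕ) : Prop where
  path : IsPath X
  pre : ∀ n ≤ M, X n = FreeGroup.of a ^ n
  stay : ∀ n, M ≤ n → (X M)⁻¹ * X n ≠ (FreeGroup.of a)⁻¹
  speed : ∀ n, n ≤ 4 * (X n).norm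
  far : ∀ ℓ, M < 2 ^ (ℓ + 1) → ¬ FarMatch X ℓ (max (4 * ℓ) M)
  near : ∀ ℓ, M ≤ 4 * ℓ → ¬ NearMatch X M ℓ
  low : ∀ ℓ, M ≤ 4 * ℓ → ¬ LowMatch X ℓ (max (8 * (ℓ / 100)) M)

variable {X : ℕ → FreeGroup α} {a : α} {M : ℕ}

/-- In the recursion, `i` is the level jumped to, `n` the number of further letters before the next
jump, and `t` the time at which the end of this run is visited. Linear escape gives `t ≤ 4 * (i +
n)`, and the next jump starts from level `i + n`. -/
theorem chain_mem_chainStrings (hspeed : ∀ n, n ≤ 4 * (X n).norm) {s J : ℕ} {u v : FreeGroup α}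
    {p w : List (α × Bool)} {x : α × Bool} (hu : ∃ n, u = X n) (hp : u.toWord = p ++ [x])
    (hJ : 2 ^ u.norm ≤ J) (h : Chain X u w v) (hw : w.length + 1 = s) :
    x :: w ∈ chainStrings X s J := by
  induction s using Nat.strong_induction_on generalizing J u p w x with
  | _ s ih =>
    obtain ⟨s, rfl⟩ : ∃ s', s = s' + 1 := ⟨w.length, hw.symm⟩
    obtain ⟨w₁, w₂, u₁, rfl, h1, ⟨t, rfl⟩, h3⟩ := h.run hu
    have hun : u.norm = p.length + 1 := by simp [FreeGroup.norm, hp]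
    have hn1 : (X t).norm = u.norm + w₁.length := by simp [FreeGroup.norm, h1]
    simp only [List.length_append] at hw
    rw [chainStrings]
    simp only [Finset.mem_biUnion, Finset.mem_Icc, Finset.mem_image, Finset.mem_range]
    refine ⟨u.norm, ⟨by omega, Nat.le_log_of_pow_le (by norm_num) hJ⟩, ⟨w₁.length, by omega⟩,
      Finset.mem_univ _, t, ?_, w₂, ?_, ?_⟩
    · have := hspeed t
      simp only; omega
    · rcases h3 with rfl | ⟨y, w₃, u₂, p', rfl, hp', hle, hu₂, hc⟩
      · have : s - w₁.length = 0 := by simp at hw; omega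
        simp only [this, chainStrings, Finset.mem_singleton]
      · simp only [List.length_cons] at hw
        refine ih _ (by simp only; omega) hu₂ hp' ?_ hc (by simp only; omega)
        simpa [hn1] using hle
    · rw [h1, hp, hun]
      simp

/-- Any cancellation into the prefix `a ^ M` would make the shifted walk pass through `a⁻¹`. -/
theorem IsPath.toWord_eq_replicate_append (hX : IsPath X) (hpre : X M = FreeGroup.of a ^ M)
    (hstay : ∀ n, M ≤ n → (X M)⁻¹ * X n ≠ (FreeGroup.of a)⁻¹) {n : ℕ} (hn : M ≤ n) :
    (X n).toWord = List.replicate M (a, true) ++ ((X M)⁻¹ * X n).toWord := by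
  obtain ⟨c, s, t, h1, h2, h3⟩ := toWord_inv_mul_decomp (X M) (X n)
  rw [hpre, FreeGroup.toWord_of_pow] at h1
  rcases List.eq_nil_or_concat s with rfl | ⟨s, y, rfl⟩
  · rw [h1, h2, h3]; simp [invRev]
  · exfalso
    have hy : y = (a, true) := by
      have : y ∈ List.replicate M (a, true) := by rw [h1]; simp
      exact List.eq_of_mem_replicate this
    subst hy
    have hpath : IsPath fun k => (X M)⁻¹ * X (M + k) := by
      refine ⟨by simp, fun k => ?_⟩
      obtain ⟨x, hx⟩ := hX.step (M + k)
      exact ⟨x, by rw [← add_assoc, hx, mul_assoc]⟩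
    obtain ⟨k, -, hk⟩ := hpath.exists_of_prefix (n := n - M) (p := [(a, false)]) (by
      simp only [Nat.add_sub_cancel' hn, h3]
      simp [invRev])
    refine hstay (M + k) (by omega) (FreeGroup.toWord_injective ?_)
    rw [hk, FreeGroup.toWord_inv, FreeGroup.toWord_of]
    simp [invRev]

namespace GoodPath

variable (hX : GoodPath X a M)
include hX

theorem toWord_pre {n : ℕ} (hn : n ≤ M) : (X n).toWord = List.replicate n (a, true) := by
  rw [hX.pre n hn, FreeGroup.toWord_of_pow]

theorem toWord_eq {n : ℕ} (hn : M ≤ n) :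
    (X n).toWord = List.replicate M (a, true) ++ ((X M)⁻¹ * X n).toWord :=
  hX.path.toWord_eq_replicate_append (hX.pre M le_rfl) hX.stay hn

theorem letter_eq {n : ℕ} {p q : List (α × Bool)} {x : α × Bool} (h : (X n).toWord = p ++ x :: q)
    (hp : p.length < M) : x = (a, true) := by
  rcases le_total n M with hn | hn
  · rw [hX.toWord_pre hn] at h
    have : x ∈ List.replicate n (a, true) := by rw [h]; simp
    exact List.eq_of_mem_replicate this
  · rw [hX.toWord_eq hn] at h
    have := congrArg (fun L => L[p.length]?) h
    simp [List.getElem?_append, hp] at this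
    exact this.symm

theorem letter_mem_eq {n : ℕ} {c : List (α × Bool)} {x : α × Bool} (h : c <+: (X n).toWord)
    (hc : c.length ≤ M) (hx : x ∈ c) : x = (a, true) := by
  obtain ⟨t, ht⟩ := h
  obtain ⟨p, q, rfl⟩ := List.append_of_mem hx
  simp at hc
  exact hX.letter_eq (p := p) (q := q ++ t) (by rw [← ht]; simp) (by omega)

/-- The first `M` letters of any `X m` are `a`, so a string of letters `a⁻¹` must come after them.
-/
theorem infix_of_neg {m : ℕ} {S : List (α × Bool)} (hS : S ≠ []) (h : S <:+: (X m).toWord)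
    (hneg : ∀ x ∈ S, x = (a, false)) : M ≤ m ∧ S <:+: ((X M)⁻¹ * X m).toWord := by
  obtain ⟨p, q, h⟩ := h
  have hp : M ≤ p.length := by
    by_contra hlt
    obtain ⟨x, S, rfl⟩ := List.exists_cons_of_ne_nil hS
    have h1 := hX.letter_eq (p := p) (x := x) (q := S ++ q) (n := m) (by rw [← h]; simp) (by omega)
    have h2 := hneg x (by simp)
    rw [h1] at h2
    simp at h2
  have hm : M ≤ m := by
    have := hX.path.norm_le m
    rw [FreeGroup.norm, ← h] at this
    simp at this; omega
  refine ⟨hm, ?_⟩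
  rw [hX.toWord_eq hm] at h
  exact infix_of_append_eq h.symm (by simpa using hp)

/-- This removes the requirement `M ≤ n`. For `n < M` the vertex `X k` is a power of `a`, so `S`
consists of letters `a⁻¹`, lies beyond the prefix, and `n` can be replaced by `M`. -/
theorem nearMatch_of {ℓ n m k : ℕ} {S : List (α × Bool)} (hK : 0 < ℓ / 100)
    (hnm : n ≤ m) (hm : m ≤ 20 * ℓ) (hk : k ≤ n) (hS : ℓ / 100 ≤ S.length)
    (h1 : invRev S <:+: (X k).toWord) (h2 : S <:+: ((X n)⁻¹ * X m).toWord) : NearMatch X M ℓ := by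
  have hT : S.take (ℓ / 100) <:+: S := (List.take_prefix _ _).isInfix
  have hlen : (S.take (ℓ / 100)).length = ℓ / 100 := by simpa using hS
  rcases le_or_gt M n with hn | hn
  · exact ⟨n, m, hn, hnm, hm, k, hk, _, hlen, (invRev_infix hT).trans h1, hT.trans h2⟩
  · have hneg : ∀ x ∈ S, x = (a, false) := by
      intro x hx
      have : flipLetter x ∈ (X k).toWord :=
        h1.subset (mem_invRev (by simpa using hx))
      rw [hX.toWord_pre (by omega)] at this
      have := List.eq_of_mem_replicate this
      rw [← flipLetter_flipLetter x, this]; rfl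
    have hpre : (X m).toWord = (X n).toWord ++ (X m).toWord.drop n := by
      rw [hX.toWord_pre hn.le]
      rcases le_total m M with h | h
      · rw [hX.toWord_pre h, List.drop_replicate, List.replicate_append_replicate]
        congr 1; omega
      · rw [hX.toWord_eq h, List.drop_append_of_le_length (by simpa using hn.le), ← List.append_assoc,
          List.drop_replicate, List.replicate_append_replicate]
        congr 2; omega
    rw [toWord_inv_mul_of_prefix hpre] at h2
    have hne : S ≠ [] := by rintro rfl; simp at hS; omega
    obtain ⟨hmM, h3⟩ := hX.infix_of_neg hne (h2.trans (List.drop_suffix _ _).isInfix) hneg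
    exact ⟨M, m, le_rfl, hmM, hm, k, by omega, _, hlen, (invRev_infix hT).trans h1, hT.trans h3⟩

/-- The two occurrences may overlap. Cut the word after the first half of the occurrence that starts
earlier; the inverse of that half is the second half of the other occurrence, so it lies behind the
cut. -/
theorem nearMatch_of_self {ℓ n : ℕ} {P : List (α × Bool)} (hK : 0 < ℓ / 100)
    (hn : n ≤ 20 * ℓ) (hP : 4 * (ℓ / 100) ≤ P.length) (h1 : P <:+: (X n).toWord)
    (h2 : invRev P <:+: (X n).toWord) : NearMatch X M ℓ := by
  obtain ⟨p₁, q₁, e₁⟩ := h1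
  obtain ⟨p₂, q₂, e₂⟩ := h2
  obtain ⟨A, B, rfl, hA⟩ : ∃ A B, P = A ++ B ∧ A.length = P.length / 2 :=
    ⟨P.take (P.length / 2), P.drop (P.length / 2), by simp, by simp; omega⟩
  simp only [List.length_append] at hP hA
  rw [FreeGroup.invRev_append] at e₂
  rcases le_or_gt p₁.length p₂.length with h | h
  · have e : (X n).toWord = (p₁ ++ A) ++ (B ++ q₁) := by rw [← e₁]; simp
    obtain ⟨k, hk, hkw⟩ := hX.path.exists_of_prefix (n := n) (p := p₁ ++ A) ⟨_, e.symm⟩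
    refine hX.nearMatch_of hK hk hn le_rfl (S := invRev A) (by simp; omega) ?_ ?_
    · rw [hkw]; simpa using (List.suffix_append p₁ A).isInfix
    · rw [toWord_inv_mul_of_prefix (t := B ++ q₁) (by rw [hkw, e])]
      refine infix_of_append_eq (x := p₁ ++ A) (z := p₂ ++ invRev B) (q := q₂) ?_ ?_
      · rw [← e, ← e₂]; simp
      · simp; omega
  · have e : (X n).toWord = (p₂ ++ invRev B) ++ (invRev A ++ q₂) := by rw [← e₂]; simp
    obtain ⟨k, hk, hkw⟩ := hX.path.exists_of_prefix (n := n) (p := p₂ ++ invRev B) ⟨_, e.symm⟩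
    refine hX.nearMatch_of hK hk hn le_rfl (S := B) (by omega) ?_ ?_
    · rw [hkw]; exact (List.suffix_append p₂ _).isInfix
    · rw [toWord_inv_mul_of_prefix (t := invRev A ++ q₂) (by rw [hkw, e])]
      refine infix_of_append_eq (x := p₂ ++ invRev B) (z := p₁ ++ A) (q := q₁) ?_ ?_
      · rw [← e, ← e₁]; simp
      · simp; omega

/-- For `n ≤ m`, split `P` at the end of the common prefix `c` of `X n` and `X m`. Either the part
behind `c` is long and occurs in `(X n)⁻¹ * X m`, or the part inside `c` is long and occurs in `X n`
together with its inverse. -/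
theorem nearMatch_of_pair {ℓ m n : ℕ} {P : List (α × Bool)} (hK : 0 < ℓ / 100)
    (hn : n ≤ 20 * ℓ) (hm : m ≤ 20 * ℓ) (hP : 5 * (ℓ / 100) ≤ P.length)
    (h1 : P <:+: (X m).toWord) (h2 : invRev P <:+: (X n).toWord) : NearMatch X M ℓ := by
  wlog hnm : n ≤ m generalizing m n P
  · exact this hm hn (P := invRev P) (by simpa using hP) h2 (by simpa using h1) (by omega)
  obtain ⟨c, s, t, hc, ht, hz⟩ := toWord_inv_mul_decomp (X n) (X m)
  obtain ⟨p, q, e⟩ := h1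
  -- `r` letters of `P` (or all of `P`, if it is shorter) lie inside `c`; truncated subtraction
  -- gives `0` when `P` begins behind `c`.
  set r := c.length - p.length
  have hsub1 : P.take r <:+: P := (List.take_prefix _ _).isInfix
  have hsub2 : P.drop r <:+: P := (List.drop_suffix _ _).isInfix
  by_cases hlong : ℓ / 100 ≤ (P.drop r).length
  · refine hX.nearMatch_of hK hnm hm le_rfl (S := P.drop r) hlong
      ((invRev_infix hsub2).trans h2) ?_
    have : P.drop r <:+: t := by
      refine infix_of_append_eq (x := c) (z := p ++ P.take r) (q := q) ?_ ?_
      · rw [← ht, ← e, List.append_assoc p (P.take r), List.take_append_drop]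
      · simp at hlong ⊢; omega
    rw [hz]
    exact this.trans (List.suffix_append _ _).isInfix
  · have hr : (P.take r).length ≤ r ∧ 4 * (ℓ / 100) ≤ (P.take r).length := by
      simp at hlong ⊢; omega
    refine hX.nearMatch_of_self hK hn hr.2 ?_ ((invRev_infix hsub1).trans h2)
    have hpre : p ++ P.take r <+: c := by
      refine List.prefix_of_prefix_length_le (l₃ := (X m).toWord) ?_ ⟨t, ht.symm⟩ ?_
      · refine ⟨P.drop r ++ q, ?_⟩
        rw [← e, ← List.append_assoc, List.append_assoc p, List.take_append_drop]
      · simp; omega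
    rw [hc]
    exact ((List.suffix_append _ _).isInfix.trans hpre.isInfix).trans (List.prefix_append _ _).isInfix

/-- A chain climbs at most one level per letter, so this reading never leaves the levels on which
the only letter is `a`. -/
theorem chain_letter_eq {u v : FreeGroup α} {w : List (α × Bool)} (h : Chain X u w v)
    (hM : u.norm + w.length ≤ M) {x : α × Bool} (hx : x ∈ w) : x = (a, true) := by
  induction h with
  | nil => simp at hx
  | @cons u y u' w v hs hc ih =>
    obtain ⟨⟨n, rfl⟩, hs⟩ := hs
    simp only [List.length_cons] at hM
    have hn : (X n).norm ≤ u.norm + 1 ∧ ∃ p, (X n).toWord = p ++ [y] := by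
      rcases hs with h | ⟨p, hp, hle⟩
      · exact ⟨by simp [FreeGroup.norm, h], _, h⟩
      · have := Nat.lt_two_pow_self (n := (X n).norm)
        exact ⟨by omega, p, hp⟩
    rcases List.mem_cons.1 hx with rfl | hx
    · obtain ⟨p, hp⟩ := hn.2
      have : (X n).norm = p.length + 1 := by simp [FreeGroup.norm, hp]
      exact hX.letter_eq hp (by omega)
    · exact ih (by omega) hx

end GoodPath

end Matches

/-! ### A good path excludes deep cancellation -/

section Matches

variable {α : Type*} [DecidableEq α]

open FreeGroup (invRev)

namespace GoodPath

variable {X : ℕ → FreeGroup α} {a : α} {M : ℕ} (hX : GoodPath X a M)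
include hX

theorem eq_neg_of_mem_invRev {n : ℕ} {c : List (α × Bool)} (hc : c <+: (X n).toWord)
    (hcM : c.length ≤ M) {x : α × Bool} (hx : x ∈ invRev c) : x = (a, false) := by
  have := hX.letter_mem_eq hc hcM (mem_invRev hx)
  rw [← flipLetter_flipLetter x, this]; rfl

/-- The first letter read from `z` sits at a level at most `M`, hence is `a`, whereas the first
letter of `c⁻¹` is `a⁻¹`. -/
theorem not_cancel_short {n : ℕ} {c : List (α × Bool)} (hc : c <+: (X n).toWord) (hc0 : c ≠ [])
    {z v : FreeGroup α} (hch : Chain X z (invRev c) v) (hzl : z.norm < 2 ^ (c.length + 1))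
    (hM : 2 ^ (c.length + 1) ≤ M) : False := by
  have hlt := Nat.lt_two_pow_self (n := c.length + 1)
  have hne : invRev c ≠ [] := by
    intro h; apply hc0; simpa using congrArg invRev h
  have hneg := fun x hx => hX.eq_neg_of_mem_invRev hc (x := x) (by omega) hx
  obtain ⟨x, r, hxr⟩ := List.exists_cons_of_ne_nil hne
  rw [hxr] at hch hneg
  obtain ⟨y, hy, hy'⟩ := Chain.split (w := [x]) (w' := r) hch
  have := hX.chain_letter_eq hy (by simp; omega) (x := x) (by simp)
  rw [hneg x (by simp)] at this
  simp at this

/-- Here `c⁻¹` is still a power of `a⁻¹`, but `z` may lie above level `M`. A jump during the reading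
would land at level at most `|c| + 1 ≤ M` and read `a`; without a jump, `c⁻¹` occurs behind the
prefix, a far match. -/
theorem not_cancel_medium {n : ℕ} {c : List (α × Bool)} (hc : c <+: (X n).toWord) (hc0 : c ≠ [])
    {z v : FreeGroup α} (hz : ∃ n, z = X n) (hch : Chain X z (invRev c) v)
    (hzl : z.norm < 2 ^ (c.length + 1)) (hM : M < 2 ^ (c.length + 1))
    (hM' : 4 * c.length < M) : False := by
  have hlt := Nat.lt_two_pow_self (n := c.length + 1)
  have hne : invRev c ≠ [] := by
    intro h; apply hc0; simpa using congrArg invRev h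
  have hpos : 0 < c.length := List.length_pos_iff.2 hc0
  have hneg := fun x hx => hX.eq_neg_of_mem_invRev hc (x := x) (by omega) hx
  obtain ⟨w₁, w₂, u₁, e, h1, ⟨m, rfl⟩, h3⟩ := hch.run hz
  have hm : (X m).norm = z.norm + w₁.length := by simp [FreeGroup.norm, h1]
  have hlen : w₁.length + w₂.length = c.length := by
    rw [← List.length_append, ← e, FreeGroup.invRev_length]
  have hpow : 2 ^ (c.length + 2) = 2 * 2 ^ (c.length + 1) := by ring
  rcases h3 with rfl | ⟨x, w₃, u₂, p, rfl, hp, hle, ⟨k, rfl⟩, -⟩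
  · rw [List.append_nil] at e
    have hinf : invRev c <:+: (X m).toWord := by
      rw [h1, e]; exact (List.suffix_append _ _).isInfix
    obtain ⟨hMm, hinf⟩ := hX.infix_of_neg hne hinf hneg
    have hcX : (X c.length).toWord = c := by
      rw [hX.toWord_pre (by omega)]
      exact (List.eq_replicate_iff.2 ⟨rfl, fun x hx => hX.letter_mem_eq hc (by omega) hx⟩).symm
    refine hX.far c.length hM ⟨m, by omega, ?_, c.length, by omega, by omega, ?_, ?_⟩
    · have := hX.speed m
      have : 2 ^ (c.length + 4) = 8 * 2 ^ (c.length + 1) := by ring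
      omega
    · simp [FreeGroup.norm, hcX]
    · rw [hcX, max_eq_right (by omega)]
      exact (invRev_infix (List.drop_suffix _ _).isInfix).trans hinf
  · have hk : (X k).norm < c.length + 2 := by
      refine (Nat.pow_lt_pow_iff_right (a := 2) (by norm_num)).1 ?_
      omega
    have hk' : (X k).norm = p.length + 1 := by simp [FreeGroup.norm, hp]
    have h4 := hX.letter_eq hp (by omega)
    rw [hneg x (by rw [e]; simp)] at h4
    simp at h4

/-- Decompose `c⁻¹` into runs. The first one must leave more than `14K` letters, since otherwise it
gives a near or far match. The second starts at level at most `ℓ + 1` and must have fewer than `5K`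
letters, since otherwise it gives a near match. The third starts at logarithmic level with more than
`9K` letters left: `K` of them form a low string, and the remaining `8K` separate its inverse in `c`
from the initial part of the path on which the low strings depend. -/
theorem not_cancel_long (hlarge : ∀ ℓ, M ≤ 4 * ℓ → 100 ≤ ℓ ∧ 2 * ℓ < 2 ^ (ℓ / 100))
    {n : ℕ} {c : List (α × Bool)} (hc : c <+: (X n).toWord)
    {z v : FreeGroup α} (hz : ∃ n, z = X n) (hch : Chain X z (invRev c) v)
    (hzl : z.norm < 2 ^ (c.length + 1)) (hM : M < 2 ^ (c.length + 1))
    (hM' : M ≤ 4 * c.length) : False := by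
  have hlt := Nat.lt_two_pow_self (n := c.length + 1)
  obtain ⟨hl100, hl2⟩ := hlarge _ hM'
  set ℓ := c.length with hℓ
  set K := ℓ / 100 with hKdef
  have hK0 : 0 < K := by omega
  have hpow : 2 ^ (ℓ + 2) = 2 * 2 ^ (ℓ + 1) := by ring
  have hpow4 : 2 ^ (ℓ + 4) = 8 * 2 ^ (ℓ + 1) := by ring
  obtain ⟨k, -, hk⟩ := hX.path.exists_of_prefix hc
  have hkn : (X k).norm = ℓ := by simp [FreeGroup.norm, hk, hℓ]
  have hk4 : k ≤ 4 * ℓ := by have := hX.speed k; omega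
  have hkl : ℓ ≤ k := by have := hX.path.norm_le k; omega
  obtain ⟨w₁, w₂, u₁, e, h1, ⟨m₁, rfl⟩, h3⟩ := hch.run hz
  have hm₁ : (X m₁).norm = z.norm + w₁.length := by simp [FreeGroup.norm, h1]
  have hs₁ := hX.speed m₁
  have hlen : w₁.length + w₂.length = ℓ := by
    rw [← List.length_append, ← e, FreeGroup.invRev_length]
  have hce : c = invRev w₂ ++ invRev w₁ := by simpa using congrArg invRev e
  have hpair : ∀ (P : List (α × Bool)) (m : ℕ), m ≤ 20 * ℓ → 5 * K ≤ P.length →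
      P <:+: (X m).toWord → P <:+: invRev c → False := by
    intro P m hm hP hPm hPc
    refine hX.near ℓ hM' (hX.nearMatch_of_pair hK0 (n := k) (by omega) hm hP hPm ?_)
    rw [hk]
    simpa using invRev_infix hPc
  have hw₁c : w₁ <:+: invRev c := by rw [e]; exact (List.prefix_append _ _).isInfix
  have hw₁m : w₁ <:+: (X m₁).toWord := by rw [h1]; exact (List.suffix_append _ _).isInfix
  have hw₂ : 14 * K < w₂.length := by
    by_contra hcon
    rcases le_or_gt m₁ (20 * ℓ) with hnear | hfar
    · exact hpair w₁ m₁ hnear (by omega) hw₁m hw₁c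
    -- As `m₁ > 20 * ℓ`, speed gives `|X m₁| > 5 * ℓ`, so `z` has level at least `4 * ℓ` and `w₁`
    -- survives in `(X (4 * ℓ))⁻¹ * X m₁`. The bound `|z| < 2 ^ (ℓ + 1)` and speed give `m₁ ≤ 2 ^ (ℓ
    -- + 4)`.
    · refine hX.far ℓ hM ⟨m₁, by omega, by omega, k, hk4, by omega, hkn, ?_⟩
      rw [max_eq_left hM', hk, hce, List.drop_append, List.drop_eq_nil_of_le (by simp; omega),
        List.nil_append]
      have hd : w₁ <:+: ((X (4 * ℓ))⁻¹ * X m₁).toWord := by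
        have h4 := hX.path.norm_le (4 * ℓ)
        have := drop_suffix_toWord_inv_mul (X (4 * ℓ)) (X m₁) (k := z.norm) (by omega)
        rw [h1, FreeGroup.norm, List.drop_left] at this
        exact this.isInfix
      refine List.IsInfix.trans ?_ hd
      simpa using invRev_infix (List.drop_suffix (14 * (ℓ / 100) - (invRev w₂).length)
        (invRev w₁)).isInfix
  rcases h3 with rfl | ⟨x, w₃, u₂, p, rfl, hp, hle, hu₂, hc₂⟩
  · simp at hw₂
  obtain ⟨w₄, w₅, u₃, rfl, h4, ⟨m₃, rfl⟩, h6⟩ := hc₂.run hu₂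
  simp only [List.length_cons, List.length_append] at hlen hw₂
  have hu₂n : u₂.norm < ℓ + 2 := by
    refine (Nat.pow_lt_pow_iff_right (a := 2) (by norm_num)).1 ?_
    omega
  have hm₃ : (X m₃).norm = u₂.norm + w₄.length := by simp [FreeGroup.norm, h4]
  have hs₃ := hX.speed m₃
  have hw₅ : 9 * K < w₅.length := by
    by_contra hcon
    refine hpair (x :: w₄) m₃ (by omega) (by simp; omega) ?_ ?_
    · rw [h4, hp]
      simpa using (List.suffix_append p (x :: w₄)).isInfix
    · rw [e]
      exact ⟨w₁, w₅, by simp⟩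
  rcases h6 with rfl | ⟨y, w₆, u₄, p', rfl, hp', hle', hu₄, hc₄⟩
  · simp at hw₅
  simp only [List.length_cons] at hlen hw₂ hw₅
  obtain ⟨z', hz', -⟩ := Chain.split (w := w₆.take (K - 1)) (w' := w₆.drop (K - 1))
    (by simpa using hc₄)
  have hlenS : (w₆.take (K - 1)).length + 1 = K := by simp; omega
  have hle4 : 2 ^ u₄.norm ≤ 2 * ℓ := by omega
  have hmem := chain_mem_chainStrings hX.speed hu₄ hp' hle4 hz' hlenS
  have hu₄K : u₄.norm < K := by
    refine (Nat.pow_lt_pow_iff_right (a := 2) (by norm_num)).1 ?_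
    omega
  have hu₄n : u₄.norm = p'.length + 1 := by simp [FreeGroup.norm, hp']
  set S := y :: w₆.take (K - 1) with hS
  have hSlen : S.length = K := by simpa [hS] using hlenS
  have hce' : c = invRev (w₆.drop (K - 1)) ++ (invRev S ++ invRev (w₁ ++ x :: w₄)) := by
    have : invRev c = (w₁ ++ x :: w₄) ++ S ++ w₆.drop (K - 1) := by
      rw [e, hS]; simp
    have := congrArg invRev this
    rwa [FreeGroup.invRev_invRev, FreeGroup.invRev_append,
      FreeGroup.invRev_append (L₁ := w₁ ++ x :: w₄)] at this
  have hinf : invRev S <:+: (X k).toWord := by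
    rw [hk, hce']
    exact ⟨_, _, List.append_assoc _ _ _⟩
  refine hX.low ℓ hM' ?_
  rw [← hKdef]
  -- If `M ≤ 8 * K`, the letters of `c` before `S⁻¹` isolate it from the first `8 * K` steps.
  -- Otherwise `S` was read entirely below level `M`, so `S⁻¹` is a power of `a⁻¹` and lies behind
  -- the prefix.
  rcases le_or_gt M (8 * K) with hcase | hcase
  · refine ⟨k, by omega, hk4, S, hmem, hSlen, ?_⟩
    rw [max_eq_left hcase]
    have h8 := hX.path.norm_le (8 * K)
    have hdl : (invRev (w₆.drop (K - 1))).length = w₆.length - (K - 1) := by simp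
    have := drop_suffix_toWord_inv_mul (X (8 * K)) (X k)
      (k := (invRev (w₆.drop (K - 1))).length) (by omega)
    rw [hk, hce', List.drop_left] at this
    exact (List.prefix_append _ _).isInfix.trans this.isInfix
  · have hposS : ∀ s ∈ S, s = (a, true) := by
      intro s hs
      rcases List.mem_cons.1 hs with rfl | hs
      · obtain ⟨t, rfl⟩ := hu₄
        exact hX.letter_eq hp' (by omega)
      · exact hX.chain_letter_eq hz' (by omega) hs
    have hneg : ∀ s ∈ invRev S, s = (a, false) := by
      intro s hs
      rw [← flipLetter_flipLetter s, hposS _ (mem_invRev hs)]; rfl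
    have hne : invRev S ≠ [] := by
      intro h
      have := congrArg List.length h
      simp [hSlen] at this; omega
    obtain ⟨hMk, hinf'⟩ := hX.infix_of_neg hne hinf hneg
    refine ⟨k, by omega, hk4, S, hmem, hSlen, ?_⟩
    rwa [max_eq_right hcase.le]

/-- The elements read along a chain from `1` that ends on a level at least `2`. -/
theorem exists_chain_mul (hM : 8 ≤ M)
    (hlarge : ∀ ℓ, M ≤ 4 * ℓ → 100 ≤ ℓ ∧ 2 * ℓ < 2 ^ (ℓ / 100)) {g : FreeGroup α} {n : ℕ}
    (hn : M ≤ n) (hg : ∃ v, Chain X 1 g.toWord v ∧ 2 ≤ v.norm) :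
    ∃ v, Chain X 1 (g * X n).toWord v ∧ 2 ≤ v.norm := by
  obtain ⟨v, hv, hv2⟩ := hg
  obtain ⟨w, c, t, h1, h2, h3⟩ := toWord_mul_decomp g (X n)
  rw [h1] at hv
  obtain ⟨z, hz1, hz2⟩ := hv.split
  have hz : ∃ n, z = X n := hz1.visited ⟨0, hX.path.zero.symm⟩
  have hcn : c <+: (X n).toWord := ⟨t, h2.symm⟩
  rw [h3]
  -- For empty `c` this is exactly the invariant that the chain ends on a level at least `2`.
  have hzl : 2 ^ (c.length + 1) ≤ z.norm := by
    by_contra hlt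
    rw [not_le] at hlt
    rcases eq_or_ne c [] with rfl | hc0
    · simp at hlt
      cases hz2
      omega
    · rcases le_or_gt (2 ^ (c.length + 1)) M with hA | hA
      · exact hX.not_cancel_short hcn hc0 hz2 hlt hA
      · rcases lt_or_ge (4 * c.length) M with hB | hB
        · exact hX.not_cancel_medium hcn hc0 hz hz2 hlt hA hB
        · exact hX.not_cancel_long hlarge hcn hz hz2 hlt hA hB
  rcases eq_or_ne t [] with rfl | ht
  · refine ⟨z, by simpa using hz1, ?_⟩
    have : 2 ^ 1 ≤ 2 ^ (c.length + 1) := Nat.pow_le_pow_right (by norm_num) (by omega)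
    omega
  · refine ⟨X n, hz1.append (hX.path.chain_of_jump h2 ht hzl), ?_⟩
    have := hX.speed n
    omega

/-- Readability is only known to be stable under right multiplication by generators, so the
induction over the semigroup carries stability under right multiplication by `g` along with
readability of `g`. -/
theorem tailSemigroup_subset (hM : 8 ≤ M)
    (hlarge : ∀ ℓ, M ≤ 4 * ℓ → 100 ≤ ℓ ∧ 2 * ℓ < 2 ^ (ℓ / 100)) :
    (tailSemigroup X M : Set (FreeGroup α)) ⊆ allOverlapWords X := by
  let Q : FreeGroup α → Prop := fun g => ∃ v, Chain X 1 g.toWord v ∧ 2 ≤ v.norm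
  have key : ∀ g ∈ tailSemigroup X M, Q g ∧ ∀ h, Q h → Q (h * g) := by
    intro g hg
    induction hg using Subsemigroup.closure_induction with
    | mem g hg =>
      obtain ⟨n, hn, rfl⟩ := hg
      refine ⟨⟨X n, hX.path.chain_of_prefix (by simp), ?_⟩,
        fun h hh => hX.exists_chain_mul hM hlarge hn hh⟩
      have := hX.speed n
      omega
    | mul g₁ g₂ _ _ h₁ h₂ =>
      exact ⟨h₂.2 _ h₁.1, fun h hh => by rw [← mul_assoc]; exact h₂.2 _ (h₁.2 _ hh)⟩
  intro g hg
  obtain ⟨⟨v, hv, hv2⟩, -⟩ := key g hg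
  refine hv.mem_allOverlapWords hX.path ?_
  rintro rfl
  rw [FreeGroup.toWord_one] at hv
  cases hv
  simp at hv2

theorem allOverlapWords_ne_univ (hM : 0 < M) : allOverlapWords X ≠ Set.univ := by
  intro h
  have hmem : (FreeGroup.of a)⁻¹ ∈ allOverlapWords X := h ▸ Set.mem_univ _
  obtain ⟨r, -, m, n, i, j, hv, hi, -, hw⟩ := Set.mem_iUnion.1 hmem
  obtain ⟨-, -, hij, hj⟩ := hv 0
  rw [List.ofFn_succ, List.flatten_cons, FreeGroup.toWord_inv, FreeGroup.toWord_of, symbols, hi] at hw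
  rw [hi] at hij
  have hne : (X (n 0)).toWord ≠ [] := by
    intro h0
    rw [FreeGroup.norm, h0] at hj
    simp at hj; omega
  obtain ⟨x, s, hx⟩ := List.exists_cons_of_ne_nil hne
  have hxa : x = (a, true) := hX.letter_eq (p := []) (q := s) (by simpa using hx) (by simpa using hM)
  obtain ⟨b, hb⟩ : ∃ b, j 0 = b + 1 := ⟨j 0 - 1, by omega⟩
  rw [hx, hb, hxa] at hw
  simp [invRev] at hw

end GoodPath

end Matches

/-! ### Counting low chain strings, and letters that raise or lower the norm -/

section Counting

variable {α : Type*} [DecidableEq α]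

theorem sum_four_pow_mul_eight_pow (s : ℕ) :
    ∑ n ∈ Finset.range (s + 1), 4 ^ n * 8 ^ (s - n) + 4 ^ s = 2 * 8 ^ s := by
  induction s with
  | zero => simp
  | succ s ih =>
    rw [Finset.sum_range_succ]
    have h : ∑ n ∈ Finset.range (s + 1), 4 ^ n * 8 ^ (s + 1 - n)
        = 8 * ∑ n ∈ Finset.range (s + 1), 4 ^ n * 8 ^ (s - n) := by
      rw [Finset.mul_sum]
      refine Finset.sum_congr rfl fun n hn => ?_
      rw [Finset.mem_range] at hn
      rw [show s + 1 - n = (s - n) + 1 by omega, pow_succ]; ring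
    rw [h]
    have := pow_succ 4 s
    have := pow_succ 8 s
    simp; omega

theorem four_mul_add_one_mul_sq_le (j : ℕ) : (4 * j + 1) * j ^ 2 ≤ 3 * 4 ^ j := by
  rcases lt_or_ge j 2 with h | h
  · interval_cases j <;> norm_num
  · induction j, h using Nat.le_induction with
    | base => norm_num
    | succ j hj ih =>
      have h : (4 * (j + 1) + 1) * (j + 1) ^ 2 ≤ 4 * ((4 * j + 1) * j ^ 2) := by
        obtain ⟨k, rfl⟩ := Nat.exists_eq_add_of_le hj
        ring_nf
        linarith [Nat.zero_le (k ^ 2), Nat.zero_le (k ^ 3)]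
      have := pow_succ 4 j
      omega

theorem sum_four_pow_le (L : ℕ) : 3 * ∑ i ∈ Finset.Icc 1 L, 4 ^ i ≤ 4 * 4 ^ L := by
  induction L with
  | zero => simp
  | succ L ih =>
    rw [Finset.sum_Icc_succ_top (by omega), mul_add, pow_succ]
    omega

/-- The base `8` closes the induction exactly: a run contributes at most `3 * 4 ^ (i + n)`, the sum
over `n` of `4 ^ n * 8 ^ (s - n)` is at most `2 * 8 ^ s`, and the sum over `i` of `4 ^ i` is at most
`(4 / 3) * J ^ 2`, with total constant `3 * 2 * 4 / 3 = 8`. -/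
theorem card_chainStrings_le (X : ℕ → FreeGroup α) (s : ℕ) {J : ℕ} (hJ : 1 ≤ J) :
    (chainStrings X s J).card ≤ J ^ 2 * 8 ^ s := by
  induction s using Nat.strong_induction_on generalizing J with
  | _ s ih =>
    rcases s with _ | s
    · rw [chainStrings]; simpa using Nat.one_le_pow 2 J hJ
    · rw [chainStrings]
      have h1 : ∀ i ∈ Finset.Icc 1 (Nat.log 2 J),
          ((Finset.univ : Finset (Fin (s + 1))).biUnion fun n =>
            (Finset.range (4 * (i + n) + 1)).biUnion fun t =>
              (chainStrings X (s - n) (i + n)).image fun r => (X t).toWord.drop (i - 1) ++ r).card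
            ≤ 6 * 8 ^ s * 4 ^ i := by
        intro i hi
        rw [Finset.mem_Icc] at hi
        refine Finset.card_biUnion_le.trans ?_
        have h2 : ∀ n ∈ (Finset.univ : Finset (Fin (s + 1))),
            ((Finset.range (4 * (i + n) + 1)).biUnion fun t =>
              (chainStrings X (s - n) (i + n)).image
                fun r => (X t).toWord.drop (i - 1) ++ r).card
            ≤ 3 * 4 ^ i * (4 ^ (n : ℕ) * 8 ^ (s - n)) := by
          intro n _
          refine Finset.card_biUnion_le.trans ?_
          have h3 : ∀ t ∈ Finset.range (4 * (i + n) + 1),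
              ((chainStrings X (s - n) (i + n)).image
                fun r => (X t).toWord.drop (i - 1) ++ r).card ≤ (i + n) ^ 2 * 8 ^ (s - n) :=
            fun t _ => Finset.card_image_le.trans (ih _ (by omega) (by omega))
          refine (Finset.sum_le_sum h3).trans ?_
          rw [Finset.sum_const, Finset.card_range, smul_eq_mul, ← mul_assoc]
          calc _ ≤ 3 * 4 ^ (i + (n : ℕ)) * 8 ^ (s - n) :=
                Nat.mul_le_mul_right _ (four_mul_add_one_mul_sq_le _)
            _ = _ := by rw [pow_add]; ring
        refine (Finset.sum_le_sum h2).trans ?_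
        rw [← Finset.mul_sum, Fin.sum_univ_eq_sum_range (fun n => 4 ^ n * 8 ^ (s - n)) (s + 1)]
        calc _ ≤ 3 * 4 ^ i * (2 * 8 ^ s) := Nat.mul_le_mul_left _
                ((Nat.le_add_right _ _).trans_eq (sum_four_pow_mul_eight_pow s))
          _ = _ := by ring
      refine Finset.card_biUnion_le.trans ((Finset.sum_le_sum h1).trans ?_)
      rw [← Finset.mul_sum]
      have h4 := sum_four_pow_le (Nat.log 2 J)
      have h5 : 4 ^ Nat.log 2 J ≤ J ^ 2 := by
        rw [show 4 = 2 ^ 2 by norm_num, ← pow_mul, mul_comm, pow_mul]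
        exact Nat.pow_le_pow_left (Nat.pow_log_le_self 2 (by omega)) 2
      calc 6 * 8 ^ s * ∑ i ∈ Finset.Icc 1 (Nat.log 2 J), 4 ^ i
          = 2 * 8 ^ s * (3 * ∑ i ∈ Finset.Icc 1 (Nat.log 2 J), 4 ^ i) := by ring
        _ ≤ 2 * 8 ^ s * (4 * 4 ^ Nat.log 2 J) := Nat.mul_le_mul_left _ h4
        _ = 8 ^ (s + 1) * 4 ^ Nat.log 2 J := by ring
        _ ≤ 8 ^ (s + 1) * J ^ 2 := Nat.mul_le_mul_left _ h5
        _ = _ := by ring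

/-- The low strings are determined by a short initial piece of the path, so a later increment is
independent of them. -/
theorem chainStrings_congr {X Y : ℕ → FreeGroup α} (s J : ℕ)
    (h : ∀ t ≤ 4 * (Nat.log 2 J + s), X t = Y t) : chainStrings X s J = chainStrings Y s J := by
  induction s using Nat.strong_induction_on generalizing J with
  | _ s ih =>
    rcases s with _ | s
    · rw [chainStrings, chainStrings]
    · rw [chainStrings, chainStrings]
      refine Finset.biUnion_congr rfl fun i hi => Finset.biUnion_congr rfl fun n _ =>
        Finset.biUnion_congr rfl fun t ht => ?_
      rw [Finset.mem_Icc] at hi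
      rw [Finset.mem_range] at ht
      have hn := n.2
      have hlog : Nat.log 2 (i + n) < i + n := Nat.log_lt_self _ (by omega)
      rw [ih (s - n) (by omega) (i + n) fun t ht => h t (by omega), h t (by omega)]

theorem norm_mul_letter (g : FreeGroup α) (hg : g ≠ 1) :
    ∃ y, ∀ x, (g * FreeGroup.mk [x]).norm = if x = y then g.norm - 1 else g.norm + 1 := by
  have hne : g.toWord ≠ [] := by simpa [FreeGroup.toWord_eq_nil_iff] using hg
  obtain ⟨w, z, hw⟩ : ∃ w z, g.toWord = w ++ [z] :=
    ⟨_, _, (List.dropLast_append_getLast hne).symm⟩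
  refine ⟨flipLetter z, fun x => ?_⟩
  split_ifs with hx
  · rcases mul_letter_cases g x with h | h
    · exfalso
      have := FreeGroup.isReduced_toWord (x := g * FreeGroup.mk [x])
      rw [h, hw, hx] at this
      have h2 := this.infix (L₁ := [z, flipLetter z]) ⟨w, [], by simp⟩
      simp [flipLetter] at h2
    · simp [FreeGroup.norm, h]
  · rcases mul_letter_cases g x with h | h
    · simp [FreeGroup.norm, h]
    · exfalso
      rw [hw] at h
      have := (List.append_inj' h rfl).2
      simp at this
      rw [this, flipLetter_flipLetter] at hx
      exact hx rfl

theorem norm_one_mul_letter (x : α × Bool) : ((1 : FreeGroup α) * FreeGroup.mk [x]).norm = 1 := by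
  rcases mul_letter_cases (1 : FreeGroup α) x with h | h
  · simp only [FreeGroup.norm, h]; simp
  · simp at h

theorem sum_norm_mul_letter [Fintype α] {β : Type*} [AddCommMonoid β] (f : ℕ → β)
    (g : FreeGroup α) (hg : g ≠ 1) :
    ∑ x : α × Bool, f (g * FreeGroup.mk [x]).norm =
      f (g.norm - 1) + (2 * Fintype.card α - 1) • f (g.norm + 1) := by
  obtain ⟨y, hy⟩ := norm_mul_letter g hg
  rw [← Finset.add_sum_erase _ _ (Finset.mem_univ y), hy y, if_pos rfl]
  congr 1
  rw [Finset.sum_congr rfl (g := fun _ => f (g.norm + 1))]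
  · rw [Finset.sum_const, Finset.card_erase_of_mem (Finset.mem_univ y)]
    simp [mul_comm]
  · intro x hx
    rw [hy x, if_neg (Finset.ne_of_mem_erase hx)]

end Counting

/-! ### Independence of increments, by splicing two sequences -/

section Increments

variable {G : Type*} [Group G]

theorem walk_congr {ζ ζ' : ℕ → G} {n : ℕ} (h : ∀ i < n, ζ i = ζ' i) : walk ζ n = walk ζ' n := by
  induction n with
  | zero => rfl
  | succ n ih =>
    rw [walk, walk, ih fun i hi => h i (by omega), h n (by omega)]

/-- The sequence that follows `ζ` for `n` steps and continues with `ζ'`. -/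
def splice (n : ℕ) (ζ ζ' : ℕ → G) : ℕ → G := fun i => if i < n then ζ i else ζ' (i - n)

theorem walk_splice_add (n k : ℕ) (ζ ζ' : ℕ → G) :
    walk (splice n ζ ζ') (n + k) = walk ζ n * walk ζ' k := by
  induction k with
  | zero =>
    rw [add_zero, walk, mul_one]
    exact walk_congr fun i hi => by simp [splice, hi]
  | succ k ih => rw [← add_assoc, walk, ih, walk, mul_assoc]; simp [splice]

theorem walk_splice {n : ℕ} (ζ ζ' : ℕ → G) : walk (splice n ζ ζ') n = walk ζ n := by
  simpa [walk] using walk_splice_add n 0 ζ ζ'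

variable [MeasurableSpace G] (μ : Measure G) [IsProbabilityMeasure μ]

instance : IsProbabilityMeasure (incrementLaw μ) := by
  unfold incrementLaw; infer_instance

omit [Group G] in
theorem measurePreserving_splice (n : ℕ) :
    MeasurePreserving (fun p : (ℕ → G) × (ℕ → G) => splice n p.1 p.2)
      ((incrementLaw μ).prod (incrementLaw μ)) (incrementLaw μ) := by
  have hmeas : Measurable (fun p : (ℕ → G) × (ℕ → G) => splice n p.1 p.2) := by
    refine measurable_pi_lambda _ fun i => ?_
    by_cases hi : i < n
    · simp only [splice, hi, if_true]
      exact (measurable_pi_apply i).comp measurable_fst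
    · simp only [splice, hi, if_false]
      exact (measurable_pi_apply (i - n)).comp measurable_snd
  refine ⟨hmeas, ?_⟩
  refine Measure.eq_infinitePi _ fun s t ht => ?_
  rw [Measure.map_apply hmeas (.pi s.countable_toSet fun i _ => ht i)]
  have hset : (fun p : (ℕ → G) × (ℕ → G) => splice n p.1 p.2) ⁻¹' (Set.pi s t) =
      (Set.pi (s.filter (· < n)) t) ×ˢ
        (Set.pi ((s.filter (¬ · < n)).image (· - n)) fun i => t (i + n)) := by
    ext ⟨ζ, ζ'⟩
    simp only [Set.mem_preimage, Set.mem_pi, Finset.mem_coe, Set.mem_prod, Finset.mem_filter,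
      Finset.mem_image]
    constructor
    · intro h
      refine ⟨fun i hi => ?_, ?_⟩
      · have := h i hi.1
        rwa [splice, if_pos hi.2] at this
      · rintro _ ⟨i, ⟨hi, hn⟩, rfl⟩
        have := h i hi
        rw [splice, if_neg hn] at this
        rwa [Nat.sub_add_cancel (not_lt.1 hn)]
    · rintro ⟨h1, h2⟩ i hi
      by_cases hn : i < n
      · rw [splice, if_pos hn]; exact h1 i ⟨hi, hn⟩
      · rw [splice, if_neg hn]
        have := h2 (i - n) ⟨i, ⟨hi, hn⟩, rfl⟩
        rwa [Nat.sub_add_cancel (not_lt.1 hn)] at this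
  rw [hset, Measure.prod_prod, incrementLaw, Measure.infinitePi_pi _ fun i _ => ht i,
    Measure.infinitePi_pi _ fun i _ => ht (i + n), ← Finset.prod_filter_mul_prod_filter_not s (· < n)]
  congr 1
  rw [Finset.prod_image]
  · refine Finset.prod_congr rfl fun i hi => ?_
    rw [Nat.sub_add_cancel (not_lt.1 (Finset.mem_filter.1 hi).2)]
  · intro i hi j hj hij
    simp only [Finset.coe_filter, Set.mem_ofPred_eq] at hi hj
    simp only at hij
    omega

theorem measurable_walk [MeasurableMul₂ G] (n : ℕ) : Measurable fun ζ : ℕ → G => walk ζ n := by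
  induction n with
  | zero => exact measurable_const
  | succ n ih => exact ih.mul (measurable_pi_apply n)

variable [Countable G] [DiscreteMeasurableSpace G]

omit [Group G] in
/-- A set of sequences that only depends on the first `n` coordinates is measurable. -/
theorem measurableSet_of_dependsOn {n : ℕ} {F : Set (ℕ → G)}
    (hF : ∀ ζ ζ' : ℕ → G, (∀ i < n, ζ i = ζ' i) → ζ ∈ F → ζ' ∈ F) : MeasurableSet F := by
  let r : (ℕ → G) → (Fin n → G) := fun ζ i => ζ i
  have hr : Measurable r := measurable_pi_lambda _ fun i => measurable_pi_apply _
  have : F = r ⁻¹' (r '' F) := by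
    refine Set.Subset.antisymm (Set.subset_preimage_image _ _) ?_
    rintro ζ ⟨ζ', h', e⟩
    exact hF ζ' ζ (fun i hi => congrFun e ⟨i, hi⟩) h'
  rw [this]
  exact hr (MeasurableSet.of_discrete)

/-- If an event about the increments after time `n` has probability at most `ε` whatever the first
`n` increments are, then its intersection with an event `F` about the first `n` increments has
probability at most `μ F * ε`. -/
theorem measure_inter_le_mul [MeasurableMul₂ G] {n k : ℕ} {F : Set (ℕ → G)}
    (hF : ∀ ζ ζ' : ℕ → G, (∀ i < n, ζ i = ζ' i) → ζ ∈ F → ζ' ∈ F)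
    {B : (ℕ → G) → Set G} (hB : ∀ ζ ζ' : ℕ → G, (∀ i < n, ζ i = ζ' i) → B ζ = B ζ')
    {ε : ℝ≥0∞} (hε : ∀ ζ ∈ F, incrementLaw μ {ζ' | walk ζ' k ∈ B ζ} ≤ ε) :
    incrementLaw μ {ζ | ζ ∈ F ∧ (walk ζ n)⁻¹ * walk ζ (n + k) ∈ B ζ} ≤ incrementLaw μ F * ε := by
  have hFm := measurableSet_of_dependsOn hF
  have hEm : MeasurableSet {ζ : ℕ → G | ζ ∈ F ∧ (walk ζ n)⁻¹ * walk ζ (n + k) ∈ B ζ} := by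
    refine measurableSet_of_dependsOn (n := n + k) fun ζ ζ' h hζ => ⟨?_, ?_⟩
    · exact hF ζ ζ' (fun i hi => h i (by omega)) hζ.1
    · rw [← walk_congr h, ← walk_congr (n := n) fun i hi => h i (by omega),
        ← hB ζ ζ' fun i hi => h i (by omega)]
      exact hζ.2
  have hsplice : ∀ ζ ζ' : ℕ → G, ∀ i < n, splice n ζ ζ' i = ζ i := fun ζ ζ' i hi => by
    simp [splice, hi]
  -- Splicing realises past and future as independent copies; for a fixed past in `F` the future has
  -- conditional probability at most `ε`, and Fubini concludes.
  rw [← (measurePreserving_splice μ n).measure_preimage hEm.nullMeasurableSet,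
    Measure.prod_apply ((measurePreserving_splice μ n).measurable hEm)]
  have hle : ∀ ζ : ℕ → G, incrementLaw μ (Prod.mk ζ ⁻¹' ((fun p : (ℕ → G) × (ℕ → G) =>
      splice n p.1 p.2) ⁻¹' {ζ | ζ ∈ F ∧ (walk ζ n)⁻¹ * walk ζ (n + k) ∈ B ζ}))
      ≤ F.indicator (fun _ => ε) ζ := by
    intro ζ
    by_cases hζ : ζ ∈ F
    · rw [Set.indicator_of_mem hζ]
      refine (measure_mono ?_).trans (hε ζ hζ)
      intro ζ' h
      have h2 : (walk (splice n ζ ζ') n)⁻¹ * walk (splice n ζ ζ') (n + k) ∈ B (splice n ζ ζ') := h.2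
      rw [walk_splice, walk_splice_add, inv_mul_cancel_left, hB _ ζ (hsplice ζ ζ')] at h2
      exact h2
    · rw [Set.indicator_of_notMem hζ, nonpos_iff_eq_zero, ← nonpos_iff_eq_zero]
      refine (measure_mono (t := ∅) ?_).trans (by simp)
      intro ζ' h
      exact hζ (hF _ _ (hsplice ζ ζ') h.1)
  refine (lintegral_mono hle).trans ?_
  rw [lintegral_indicator hFm, setLIntegral_const, mul_comm]

theorem lintegral_walk_succ [MeasurableMul₂ G] (k : ℕ) (f : G → ℝ≥0∞) :
    ∫⁻ ζ, f (walk ζ (k + 1)) ∂(incrementLaw μ) =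
      ∫⁻ g, ∫⁻ ζ, f (walk ζ k * g) ∂(incrementLaw μ) ∂μ := by
  have hf : Measurable f := measurable_of_countable f
  have h1 := (measurePreserving_splice μ k).lintegral_comp (f := fun ζ => f (walk ζ (k + 1)))
    (hf.comp (measurable_walk _))
  rw [← h1]
  simp only [walk_splice_add k 1]
  have h2 : ∀ ζ' : ℕ → G, walk ζ' 1 = ζ' 0 := fun ζ' => by simp [walk]
  simp only [h2]
  have hm : Measurable fun p : (ℕ → G) × (ℕ → G) => f (walk p.1 k * p.2 0) :=
    hf.comp (((measurable_walk k).comp measurable_fst).mul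
      ((measurable_pi_apply 0).comp measurable_snd))
  rw [lintegral_prod_symm _ hm.aemeasurable]
  have h3 := (measurePreserving_eval_infinitePi (fun _ : ℕ => μ) 0).lintegral_comp
    (f := fun g => ∫⁻ ζ, f (walk ζ k * g) ∂(incrementLaw μ)) (measurable_of_countable _)
  exact h3

end Increments

/-! ### One step of the walk, and radial symmetry of its law -/

section FreeWalk

instance {α : Type*} [Countable α] : MeasurableMul₂ (FreeGroup α) :=
  ⟨measurable_of_countable _⟩

theorem standardGenerators_eq (d : ℕ) :
    standardGenerators d =
      ((Finset.univ : Finset (Fin d × Bool)).image fun x => FreeGroup.mk [x] : Set _) := by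
  ext g
  simp only [standardGenerators, Finset.coe_image, Finset.coe_univ, Set.image_univ, Set.mem_range,
    Prod.exists, Bool.exists_bool]
  constructor
  · rintro ⟨b, rfl | rfl⟩
    · exact ⟨b, .inr rfl⟩
    · exact ⟨b, .inl rfl⟩
  · rintro ⟨b, rfl | rfl⟩
    · exact ⟨b, .inr rfl⟩
    · exact ⟨b, .inl rfl⟩

theorem mk_singleton_injective {α : Type*} :
    Function.Injective fun x : α × Bool => FreeGroup.mk [x] := by
  classical
  intro x y h
  have := congrArg FreeGroup.toWord h
  simpa [FreeGroup.toWord_mk] using this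

theorem isProbabilityMeasure_stdMeasure {d : ℕ} (hd : 0 < d) :
    IsProbabilityMeasure (stdMeasure d) := by
  refine isProbabilityMeasure_uniformOn ?_ ⟨FreeGroup.of ⟨0, hd⟩, ⟨0, hd⟩, .inl rfl⟩
  rw [standardGenerators_eq]
  exact Finset.finite_toSet _

theorem lintegral_stdMeasure (d : ℕ) (f : FreeGroup (Fin d) → ℝ≥0∞) :
    ∫⁻ g, f g ∂(stdMeasure d) = (2 * d : ℝ≥0∞)⁻¹ * ∑ x : Fin d × Bool, f (FreeGroup.mk [x]) := by
  have hcard : ((Finset.univ : Finset (Fin d × Bool)).image fun x => FreeGroup.mk [x]).card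
      = 2 * d := by
    rw [Finset.card_image_of_injective _ mk_singleton_injective]
    simp [mul_comm]
  rw [stdMeasure, uniformOn, ProbabilityTheory.cond, standardGenerators_eq, lintegral_smul_measure,
    Measure.count_apply_finset, hcard, lintegral_finset,
    Finset.sum_image (mk_singleton_injective.injOn)]
  simp

variable {d : ℕ} [IsProbabilityMeasure (stdMeasure d)]

omit [IsProbabilityMeasure (stdMeasure d)] in
theorem measurable_comp_walk (f : FreeGroup (Fin d) → ℝ≥0∞) (k : ℕ) :
    Measurable fun ζ : ℕ → FreeGroup (Fin d) => f (walk ζ k) :=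
  (measurable_of_countable f).comp (measurable_walk k)

theorem lintegral_walk_succ_eq_sum (k : ℕ) (f : FreeGroup (Fin d) → ℝ≥0∞) :
    ∫⁻ ζ, f (walk ζ (k + 1)) ∂(incrementLaw (stdMeasure d)) =
      (2 * d : ℝ≥0∞)⁻¹ * ∫⁻ ζ, ∑ x : Fin d × Bool, f (walk ζ k * FreeGroup.mk [x])
        ∂(incrementLaw (stdMeasure d)) := by
  rw [lintegral_walk_succ, lintegral_stdMeasure, lintegral_finsetSum]
  intro x _
  exact measurable_comp_walk (fun g => f (g * FreeGroup.mk [x])) k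

omit [IsProbabilityMeasure (stdMeasure d)] in
theorem measure_walk_eq_lintegral (k : ℕ) (B : Set (FreeGroup (Fin d))) :
    incrementLaw (stdMeasure d) {ζ | walk ζ k ∈ B} =
      ∫⁻ ζ, B.indicator 1 (walk ζ k) ∂(incrementLaw (stdMeasure d)) := by
  have h := lintegral_indicator_one (μ := incrementLaw (stdMeasure d))
    ((measurable_walk k) (MeasurableSet.of_discrete (s := B)))
  exact h.symm

omit [IsProbabilityMeasure (stdMeasure d)] in
theorem measure_walk_eq_lintegral_ite (k : ℕ) (q : FreeGroup (Fin d) → Prop) [DecidablePred q] :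
    incrementLaw (stdMeasure d) {ζ | q (walk ζ k)} =
      ∫⁻ ζ, (if q (walk ζ k) then 1 else 0) ∂(incrementLaw (stdMeasure d)) := by
  refine (measure_walk_eq_lintegral k {g | q g}).trans (lintegral_congr fun ζ => ?_)
  simp [Set.indicator_apply]

/-- The distribution of the walk is constant on spheres. -/
theorem exists_measure_walk_eq (k : ℕ) : ∃ H : ℕ → ℝ≥0∞, ∀ w : FreeGroup (Fin d),
    incrementLaw (stdMeasure d) {ζ | walk ζ k = w} = H w.norm := by
  induction k with
  | zero =>
    refine ⟨fun n => if n = 0 then 1 else 0, fun w => ?_⟩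
    by_cases hw : w = 1
    · simp [walk, hw]
    · have : (1 : FreeGroup (Fin d)) ≠ w := fun h => hw h.symm
      simp [walk, hw, this]
  | succ k ih =>
    obtain ⟨H, hH⟩ := ih
    have hrec : ∀ w : FreeGroup (Fin d), incrementLaw (stdMeasure d) {ζ | walk ζ (k + 1) = w} =
        (2 * d : ℝ≥0∞)⁻¹ * ∑ x : Fin d × Bool, H (w * FreeGroup.mk [x]).norm := by
      intro w
      have h1 := measure_walk_eq_lintegral (d := d) (k + 1) {w}
      simp only [Set.mem_singleton_iff] at h1
      rw [h1, lintegral_walk_succ_eq_sum, lintegral_finsetSum]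
      · congr 1
        -- The last step `x` leads to `w` exactly from `w x⁻¹`, so the sum over steps is reindexed
        -- by inverting letters.
        refine Fintype.sum_equiv (Equiv.refl (Fin d) |>.prodCongr Equiv.boolNot) _ _ fun x => ?_
        rw [← hH]
        have h2 := measure_walk_eq_lintegral (d := d) k {w * FreeGroup.mk [(x.1, !x.2)]}
        simp only [Set.mem_singleton_iff] at h2
        have h3 : w * FreeGroup.mk [(Equiv.refl (Fin d) |>.prodCongr Equiv.boolNot) x] =
          w * FreeGroup.mk [(x.1, !x.2)] := rfl
        rw [h3, h2]
        refine lintegral_congr fun ζ => ?_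
        have h4 : FreeGroup.mk [(x.1, !x.2)] = (FreeGroup.mk [x])⁻¹ := by
          rw [FreeGroup.inv_mk]; simp [FreeGroup.invRev]
        rw [h4]
        simp only [Set.indicator_apply, Set.mem_singleton_iff, ← eq_mul_inv_iff_mul_eq,
          Pi.one_apply]
      · intro x _
        exact measurable_comp_walk (fun g => Set.indicator {w} 1 (g * FreeGroup.mk [x])) k
    refine ⟨fun n => (2 * d : ℝ≥0∞)⁻¹ * if n = 0 then (2 * d) • H 1 else
      H (n - 1) + (2 * Fintype.card (Fin d) - 1) • H (n + 1), fun w => ?_⟩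
    rw [hrec]
    congr 1
    by_cases hw : w = 1
    · subst hw
      simp only [norm_one_mul_letter, FreeGroup.norm_one, if_true]
      simp [mul_comm]
    · rw [if_neg (by simpa [FreeGroup.norm_eq_zero] using hw), sum_norm_mul_letter H w hw]

end FreeWalk

/-! ### Masses of cones, and the probability that a string occurs -/

section Cones

/-- The cone of `w` is connected to the rest of the tree by a single edge, from the parent `p` to
`w`. The balance is arranged additively to avoid subtraction, as its integrated form lives in
`ℝ≥0∞`. -/
theorem card_filter_prefix_mul_letter {α : Type*} [DecidableEq α] [Fintype α]
    (w g : FreeGroup α) {p : List (α × Bool)} {y : α × Bool} (hw : w.toWord = p ++ [y]) :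
    (Finset.univ.filter fun x : α × Bool => w.toWord <+: (g * FreeGroup.mk [x]).toWord).card +
      (if g = w then 1 else 0) =
    2 * Fintype.card α * (if w.toWord <+: g.toWord then 1 else 0) +
      (if g.toWord = p then 1 else 0) := by
  have hcard : Fintype.card (α × Bool) = 2 * Fintype.card α := by simp [mul_comm]
  by_cases hwg : w.toWord <+: g.toWord
  · have hgp : g.toWord ≠ p := by
      intro h
      have := hwg.length_le
      rw [h, hw] at this
      simp at this
    rw [if_pos hwg, if_neg hgp, mul_one, add_zero]
    by_cases hg : g = w
    · subst hg
      have hg1 : g ≠ 1 := by rintro rfl; simp at hw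
      obtain ⟨y0, hy0⟩ := norm_mul_letter g hg1
      have hpos : 0 < g.norm := by
        rw [Nat.pos_iff_ne_zero]; simpa [FreeGroup.norm_eq_zero] using hg1
      have : (Finset.univ.filter fun x : α × Bool => g.toWord <+: (g * FreeGroup.mk [x]).toWord)
          = Finset.univ.erase y0 := by
        ext x
        simp only [Finset.mem_filter, Finset.mem_univ, true_and, Finset.mem_erase, and_true]
        constructor
        · rintro h rfl
          have h1 := h.length_le
          have h2 := hy0 x
          rw [if_pos rfl] at h2
          simp only [FreeGroup.norm] at h2 hpos
          omega
        · intro hx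
          have h2 := hy0 x
          rw [if_neg hx] at h2
          rcases mul_letter_cases g x with h | h
          · rw [h]; exact List.prefix_append _ _
          · have := congrArg List.length h
            simp only [FreeGroup.norm] at h2
            simp at this
            omega
      rw [this, Finset.card_erase_of_mem (Finset.mem_univ _), Finset.card_univ, hcard, if_pos rfl]
      have : 0 < Fintype.card α := Fintype.card_pos_iff.2 ⟨y0.1⟩
      omega
    · rw [if_neg hg, add_zero, Finset.filter_true_of_mem, Finset.card_univ, hcard]
      intro x _
      rcases mul_letter_cases g x with h | h
      · rw [h]; exact hwg.trans (List.prefix_append _ _)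
      · rw [h, List.prefix_concat_iff] at hwg
        rcases hwg with h' | h'
        · exact absurd (FreeGroup.toWord_injective (by rw [h, h'])) hg
        · exact h'
  · have hgw : g ≠ w := by rintro rfl; exact hwg List.prefix_rfl
    rw [if_neg hwg, if_neg hgw, mul_zero, zero_add, add_zero]
    have key : ∀ x, w.toWord <+: (g * FreeGroup.mk [x]).toWord → g.toWord = p ∧ x = y := by
      intro x hx
      rcases mul_letter_cases g x with h | h
      · rw [h, List.prefix_concat_iff] at hx
        rcases hx with h' | h'
        · rw [hw] at h'
          have := List.append_inj' h' rfl
          exact ⟨this.1.symm, by simpa using this.2.symm⟩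
        · exact absurd h' hwg
      · exact absurd (hx.trans (by rw [h]; exact List.prefix_append _ _)) hwg
    by_cases hgp : g.toWord = p
    · rw [if_pos hgp, Finset.card_eq_one]
      refine ⟨y, ?_⟩
      ext x
      simp only [Finset.mem_filter, Finset.mem_univ, true_and, Finset.mem_singleton]
      refine ⟨fun hx => (key x hx).2, ?_⟩
      rintro rfl
      have : g * FreeGroup.mk [x] = w := by
        rw [← FreeGroup.mk_toWord (x := g), hgp, FreeGroup.mul_mk, ← hw, FreeGroup.mk_toWord]
      rw [this]
    · rw [if_neg hgp, Finset.card_eq_zero, Finset.filter_eq_empty_iff]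
      intro x _ hx
      exact hgp (key x hx).1

variable {d : ℕ}

theorem measurableSet_walk (k : ℕ) (B : Set (FreeGroup (Fin d))) :
    MeasurableSet {ζ : ℕ → FreeGroup (Fin d) | walk ζ k ∈ B} :=
  (measurable_walk k) (MeasurableSet.of_discrete (s := B))

variable [IsProbabilityMeasure (stdMeasure d)]

/-- The probability that the walk at time `k` is in the cone of `L`. -/
noncomputable def coneMass (d k : ℕ) (L : List (Fin d × Bool)) : ℝ≥0∞ :=
  incrementLaw (stdMeasure d) {ζ | L <+: (walk ζ k).toWord}

theorem coneMass_succ (k : ℕ) (w : FreeGroup (Fin d)) {p : List (Fin d × Bool)} {y : Fin d × Bool}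
    (hw : w.toWord = p ++ [y]) :
    2 * d * coneMass d (k + 1) w.toWord + incrementLaw (stdMeasure d) {ζ | walk ζ k = w} =
      2 * d * coneMass d k w.toWord +
        incrementLaw (stdMeasure d) {ζ | (walk ζ k).toWord = p} := by
  have hd : (2 * d : ℝ≥0∞) ≠ 0 := by
    have : 0 < d := Fin.pos y.1
    simp; omega
  have hd' : (2 * d : ℝ≥0∞) ≠ ⊤ := by finiteness
  have e (k : ℕ) : coneMass d k w.toWord = ∫⁻ ζ, (if w.toWord <+: (walk ζ k).toWord then 1 else 0)
      ∂(incrementLaw (stdMeasure d)) :=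
    measure_walk_eq_lintegral_ite k fun g => w.toWord <+: g.toWord
  have e1 : incrementLaw (stdMeasure d) {ζ | walk ζ k = w} =
      ∫⁻ ζ, (if walk ζ k = w then 1 else 0) ∂(incrementLaw (stdMeasure d)) :=
    measure_walk_eq_lintegral_ite k fun g => g = w
  have e2 : incrementLaw (stdMeasure d) {ζ | (walk ζ k).toWord = p} =
      ∫⁻ ζ, (if (walk ζ k).toWord = p then 1 else 0) ∂(incrementLaw (stdMeasure d)) :=
    measure_walk_eq_lintegral_ite k fun g => g.toWord = p
  rw [e, e, e1, e2, lintegral_walk_succ_eq_sum k fun g => if w.toWord <+: g.toWord then 1 else 0,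
    ← mul_assoc, ENNReal.mul_inv_cancel hd hd', one_mul, ← lintegral_add_left,
    ← lintegral_const_mul, ← lintegral_add_left]
  · refine lintegral_congr fun ζ => ?_
    have h := card_filter_prefix_mul_letter w (walk ζ k) hw
    have h2 := congrArg (fun n : ℕ => (n : ℝ≥0∞)) h
    simp only [Fintype.card_fin] at h2
    push_cast at h2
    rw [← h2, Finset.sum_boole]
  · exact measurable_comp_walk (fun g => 2 * d * if w.toWord <+: g.toWord then 1 else 0) k
  · exact measurable_comp_walk (fun g => if w.toWord <+: g.toWord then 1 else 0) k
  · exact measurable_comp_walk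
      (fun g => ∑ x, if w.toWord <+: (g * FreeGroup.mk [x]).toWord then 1 else 0) k

omit [IsProbabilityMeasure (stdMeasure d)] in
theorem measure_toWord_eq (k : ℕ) {p L : List (Fin d × Bool)} {w : FreeGroup (Fin d)}
    (hw : w.toWord = p ++ L) :
    incrementLaw (stdMeasure d) {ζ | (walk ζ k).toWord = p} =
      incrementLaw (stdMeasure d) {ζ | walk ζ k = FreeGroup.mk p} ∧
      (FreeGroup.mk p).toWord = p := by
  have h : (FreeGroup.mk p).toWord = p := by
    rw [FreeGroup.toWord_mk]
    apply FreeGroup.IsReduced.reduce_eq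
    have := FreeGroup.isReduced_toWord (x := w)
    rw [hw] at this
    exact this.infix (List.prefix_append _ _).isInfix
  refine ⟨?_, h⟩
  congr 1
  ext ζ
  simp only [Set.mem_ofPred_eq]
  rw [← FreeGroup.toWord_inj, h]

/-- The flow through the boundary edge depends only on point masses at `w` and its parent, which are
radial; induction on time. -/
theorem coneMass_eq (k : ℕ) {w w' : FreeGroup (Fin d)} (hww : w.norm = w'.norm) :
    coneMass d k w.toWord = coneMass d k w'.toWord := by
  by_cases hw1 : w = 1
  · subst hw1
    have : w' = 1 := by simpa [FreeGroup.norm_eq_zero] using hww.symm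
    rw [this]
  have hw1' : w' ≠ 1 := by
    rintro rfl
    apply hw1
    simpa [FreeGroup.norm_eq_zero] using hww
  obtain ⟨p, y, hp⟩ : ∃ p y, w.toWord = p ++ [y] := ⟨_, _, (List.dropLast_append_getLast
    (by simpa [FreeGroup.toWord_eq_nil_iff] using hw1)).symm⟩
  obtain ⟨p', y', hp'⟩ : ∃ p y, w'.toWord = p ++ [y] := ⟨_, _, (List.dropLast_append_getLast
    (by simpa [FreeGroup.toWord_eq_nil_iff] using hw1')).symm⟩
  induction k with
  | zero => simp [coneMass, walk, hp, hp']
  | succ k ih =>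
    have hd : (2 * d : ℝ≥0∞) ≠ 0 := by
      have : 0 < d := Fin.pos y.1
      simp; omega
    have hd' : (2 * d : ℝ≥0∞) ≠ ⊤ := by finiteness
    obtain ⟨H, hH⟩ := exists_measure_walk_eq (d := d) k
    have h1 := coneMass_succ k w hp
    have h2 := coneMass_succ k w' hp'
    obtain ⟨e1, n1⟩ := measure_toWord_eq (d := d) k hp
    obtain ⟨e2, n2⟩ := measure_toWord_eq (d := d) k hp'
    have hpp : p.length = p'.length := by simpa [FreeGroup.norm, hp, hp'] using hww
    have n3 : (FreeGroup.mk p).norm = (FreeGroup.mk p').norm := by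
      rw [FreeGroup.norm, FreeGroup.norm, n1, n2, hpp]
    have hfin : H w.norm ≠ ⊤ := by rw [← hH]; exact measure_ne_top _ _
    rw [e1, hH, hH, ih, n3] at h1
    rw [e2, hH, hH, ← hww, ← h1] at h2
    rw [ENNReal.add_left_inj hfin, ENNReal.mul_right_inj hd hd'] at h2
    exact h2.symm

/-- The cone of `L` contains at least `2d - 1 ≥ 9` disjoint child cones of equal mass. If `L ++ [x]`
is not reduced, its cone is empty. -/
theorem coneMass_append_singleton (hd : 4 < d) (k : ℕ) (L : List (Fin d × Bool)) (x : Fin d × Bool) :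
    9 * coneMass d k (L ++ [x]) ≤ coneMass d k L := by
  by_cases hex : ∃ w : FreeGroup (Fin d), w.toWord = L ++ [x]
  swap
  · have : coneMass d k (L ++ [x]) = 0 := by
      rw [coneMass]
      convert measure_empty (μ := incrementLaw (stdMeasure d))
      ext ζ
      simp only [Set.mem_ofPred_eq, Set.mem_empty_iff_false, iff_false]
      rintro ⟨t, ht⟩
      exact hex ⟨_, (measure_toWord_eq (d := d) 0 ht.symm).2⟩
    simp [this]
  obtain ⟨w, hw⟩ := hex
  obtain ⟨-, hL⟩ := measure_toWord_eq (d := d) 0 hw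
  set u := FreeGroup.mk L
  let A : Finset (Fin d × Bool) :=
    Finset.univ.filter fun z => (u * FreeGroup.mk [z]).toWord = L ++ [z]
  have hA : 9 ≤ A.card := by
    have hsub : ∃ y, Finset.univ.erase y ⊆ A := by
      by_cases hu : u = 1
      · refine ⟨x, fun z _ => ?_⟩
        rcases mul_letter_cases u z with h | h
        · rw [hL] at h; simpa [A] using h
        · rw [hu] at h; simp at h
      · obtain ⟨y, hy⟩ := norm_mul_letter u hu
        refine ⟨y, fun z hz => ?_⟩
        rcases mul_letter_cases u z with h | h
        · rw [hL] at h; simpa [A] using h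
        · exfalso
          have h2 := hy z
          rw [if_neg (Finset.ne_of_mem_erase hz)] at h2
          have := congrArg List.length h
          simp only [FreeGroup.norm] at h2
          simp at this
          omega
    obtain ⟨y, hy⟩ := hsub
    refine le_trans ?_ (Finset.card_le_card hy)
    rw [Finset.card_erase_of_mem (Finset.mem_univ _), Finset.card_univ]
    simp; omega
  have hmass : ∀ z ∈ A, coneMass d k (L ++ [z]) = coneMass d k (L ++ [x]) := by
    intro z hz
    simp only [A, Finset.mem_filter, Finset.mem_univ, true_and] at hz
    rw [← hz, ← hw]
    apply coneMass_eq
    simp [FreeGroup.norm, hz, hw]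
  have hdisj : (A : Set (Fin d × Bool)).PairwiseDisjoint
      fun z => {ζ : ℕ → FreeGroup (Fin d) | L ++ [z] <+: (walk ζ k).toWord} := by
    intro z _ z' _ hzz
    rw [Function.onFun, Set.disjoint_left]
    intro ζ h1 h2
    have := List.prefix_of_prefix_length_le h1 h2 (by simp)
    have := List.IsPrefix.eq_of_length this (by simp)
    simp at this
    exact hzz this
  calc 9 * coneMass d k (L ++ [x]) ≤ A.card * coneMass d k (L ++ [x]) := by
        gcongr; exact_mod_cast hA
    _ = ∑ z ∈ A, coneMass d k (L ++ [z]) := by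
        rw [Finset.sum_congr rfl hmass, Finset.sum_const, nsmul_eq_mul]
    _ = incrementLaw (stdMeasure d) (⋃ z ∈ A, {ζ | L ++ [z] <+: (walk ζ k).toWord}) := by
        rw [measure_biUnion_finset hdisj fun z _ =>
          measurableSet_walk k {g | L ++ [z] <+: g.toWord}]
        rfl
    _ ≤ coneMass d k L := by
        refine measure_mono (Set.iUnion₂_subset fun z _ ζ h => ?_)
        exact (List.prefix_append L [z]).trans h

theorem coneMass_append (hd : 4 < d) (k : ℕ) (L S : List (Fin d × Bool)) :
    9 ^ S.length * coneMass d k (L ++ S) ≤ coneMass d k L := by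
  induction S using List.reverseRecOn with
  | nil => simp
  | append_singleton S x ih =>
    refine le_trans ?_ ih
    rw [List.length_append, pow_add, mul_assoc, ← List.append_assoc]
    gcongr
    simpa using coneMass_append_singleton hd k (L ++ S) x

omit [IsProbabilityMeasure (stdMeasure d)] in
theorem isPath_walk {ζ : ℕ → FreeGroup (Fin d)} (h : ∀ i, ζ i ∈ standardGenerators d) :
    IsPath (walk ζ) := by
  refine ⟨rfl, fun n => ?_⟩
  have := h n
  rw [standardGenerators_eq] at this
  obtain ⟨x, -, hx⟩ := Finset.mem_image.1 (Finset.mem_coe.1 this)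
  exact ⟨x, by rw [walk, ← hx]⟩

theorem ae_mem_standardGenerators :
    ∀ᵐ ζ ∂(incrementLaw (stdMeasure d)), ∀ i, ζ i ∈ standardGenerators d := by
  rw [ae_all_iff]
  intro i
  have h := (measurePreserving_eval_infinitePi (fun _ : ℕ => stdMeasure d) i).quasiMeasurePreserving
  refine h.ae (p := fun g => g ∈ standardGenerators d) ?_
  exact ae_cond_mem (by exact MeasurableSet.of_discrete)

/-- The probability that a given string occurs in the walk at time `k`. -/
theorem measure_infix_le (hd : 4 < d) (k : ℕ) (S : List (Fin d × Bool)) :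
    incrementLaw (stdMeasure d) {ζ | S <:+: (walk ζ k).toWord} ≤ (k + 1) * (9 ^ S.length)⁻¹ := by
  -- For each possible starting position `z ≤ k` of the string, sum over the preceding `z` letters;
  -- the corresponding cones are disjoint.
  have hz : ∀ z : ℕ, ∑ f : Fin z → Fin d × Bool, coneMass d k (List.ofFn f) ≤ 1 := by
    intro z
    have hdisj : Set.PairwiseDisjoint
        ((Finset.univ : Finset (Fin z → Fin d × Bool)) : Set (Fin z → Fin d × Bool))
        fun f => {ζ : ℕ → FreeGroup (Fin d) | List.ofFn f <+: (walk ζ k).toWord} := by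
      intro f _ f' _ hff
      rw [Function.onFun, Set.disjoint_left]
      intro ζ h1 h2
      have := List.prefix_of_prefix_length_le h1 h2 (by simp)
      have := List.IsPrefix.eq_of_length this (by simp)
      exact hff (List.ofFn_injective this)
    calc _ = incrementLaw (stdMeasure d)
          (⋃ f ∈ (Finset.univ : Finset (Fin z → Fin d × Bool)),
            {ζ | List.ofFn f <+: (walk ζ k).toWord}) := by
          rw [measure_biUnion_finset hdisj fun f _ =>
            measurableSet_walk k {g | List.ofFn f <+: g.toWord}]
          rfl
      _ ≤ 1 := prob_le_one
  have hcone : ∀ z : ℕ, ∀ f : Fin z → Fin d × Bool, coneMass d k (List.ofFn f ++ S) ≤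
      (9 ^ S.length)⁻¹ * coneMass d k (List.ofFn f) := by
    intro z f
    have h9 : (9 ^ S.length : ℝ≥0∞) ≠ 0 := pow_ne_zero _ (by norm_num)
    have h9' : (9 ^ S.length : ℝ≥0∞) ≠ ⊤ := by finiteness
    rw [← ENNReal.mul_le_iff_le_inv h9 h9']
    exact coneMass_append hd k _ S
  have hsub : {ζ : ℕ → FreeGroup (Fin d) | S <:+: (walk ζ k).toWord} ≤ᵐ[incrementLaw (stdMeasure d)]
      ⋃ z ∈ Finset.range (k + 1), ⋃ f ∈ (Finset.univ : Finset (Fin z → Fin d × Bool)),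
        {ζ | List.ofFn f ++ S <+: (walk ζ k).toWord} := by
    filter_upwards [ae_mem_standardGenerators (d := d)] with ζ hζ h
    obtain ⟨p, q, e⟩ := (h : S <:+: (walk ζ k).toWord)
    have hlen := (isPath_walk hζ).norm_le k
    rw [FreeGroup.norm, ← e] at hlen
    simp at hlen
    refine Set.mem_iUnion₂.2 ⟨p.length, by simp; omega, Set.mem_iUnion₂.2 ⟨p.get,
      Finset.mem_univ _, ?_⟩⟩
    simp only [List.ofFn_get, Set.mem_ofPred_eq]
    exact ⟨q, e⟩
  refine (measure_mono_ae hsub).trans ?_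
  refine (measure_biUnion_finset_le _ _).trans ?_
  have hone : ∀ z ∈ Finset.range (k + 1), incrementLaw (stdMeasure d)
      (⋃ f ∈ (Finset.univ : Finset (Fin z → Fin d × Bool)),
        {ζ | List.ofFn f ++ S <+: (walk ζ k).toWord}) ≤ (9 ^ S.length)⁻¹ := by
    intro z _
    refine (measure_biUnion_finset_le _ _).trans ?_
    refine (Finset.sum_le_sum fun f _ => hcone z f).trans ?_
    rw [← Finset.mul_sum]
    exact mul_le_of_le_one_right' (hz z)
  refine (Finset.sum_le_sum hone).trans ?_
  rw [Finset.sum_const, Finset.card_range, nsmul_eq_mul]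
  push_cast
  rfl

end Cones

/-! ### Escape rate, and occurrence of strings from the past -/

section Estimates

variable {d : ℕ}

/-- Away from `1` the mean of `3 ^ (-|·|)` after a step is multiplied by `(3 + (2d - 1) / 3) /
(2d)`, which is at most `3 / 5` for `d ≥ 5`, with equality at `d = 5`. -/
theorem sum_third_pow_norm_le (hd : 4 < d) (g : FreeGroup (Fin d)) :
    ∑ x : Fin d × Bool, (1 / 3 : ℝ) ^ (g * FreeGroup.mk [x]).norm ≤
      2 * d * (3 / 5 * (1 / 3) ^ g.norm) := by
  have hd' : (5 : ℝ) ≤ d := by exact_mod_cast hd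
  by_cases hg : g = 1
  · subst hg
    simp only [norm_one_mul_letter, FreeGroup.norm_one]
    simp
    nlinarith
  · rw [sum_norm_mul_letter (fun n => (1 / 3 : ℝ) ^ n) g hg]
    obtain ⟨r, hr⟩ : ∃ r, g.norm = r + 1 :=
      Nat.exists_eq_succ_of_ne_zero (by simpa [FreeGroup.norm_eq_zero] using hg)
    rw [hr, Nat.add_sub_cancel, nsmul_eq_mul, Nat.cast_sub (by simp; omega)]
    have hpos : (0 : ℝ) < (1 / 3) ^ r := by positivity
    simp only [Fintype.card_fin, pow_succ]
    push_cast
    nlinarith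

variable [IsProbabilityMeasure (stdMeasure d)]

theorem lintegral_third_pow_norm_le (hd : 4 < d) (k : ℕ) :
    ∫⁻ ζ, ENNReal.ofReal ((1 / 3) ^ (walk ζ k).norm) ∂(incrementLaw (stdMeasure d)) ≤
      ENNReal.ofReal ((3 / 5) ^ k) := by
  induction k with
  | zero => simp [walk]
  | succ k ih =>
    have hd0 : (2 * d : ℝ≥0∞) ≠ 0 := by simp; omega
    have hd' : (2 * d : ℝ≥0∞) ≠ ⊤ := by finiteness
    rw [lintegral_walk_succ_eq_sum k fun g => ENNReal.ofReal ((1 / 3) ^ g.norm)]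
    calc _ ≤ (2 * d : ℝ≥0∞)⁻¹ * ∫⁻ ζ, 2 * d * (ENNReal.ofReal (3 / 5) *
            ENNReal.ofReal ((1 / 3) ^ (walk ζ k).norm)) ∂(incrementLaw (stdMeasure d)) := by
          gcongr with ζ
          rw [← ENNReal.ofReal_sum_of_nonneg fun x _ => by positivity]
          have h2 : (2 * d : ℝ≥0∞) = ENNReal.ofReal (2 * d) := by
            rw [ENNReal.ofReal_mul (by norm_num)]; simp
          rw [h2, ← ENNReal.ofReal_mul (by norm_num), ← ENNReal.ofReal_mul (by positivity)]
          exact ENNReal.ofReal_le_ofReal (sum_third_pow_norm_le hd _)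
      _ = ENNReal.ofReal (3 / 5) * ∫⁻ ζ, ENNReal.ofReal ((1 / 3) ^ (walk ζ k).norm)
            ∂(incrementLaw (stdMeasure d)) := by
          have hm := measurable_comp_walk (d := d) (fun g => ENNReal.ofReal ((1 / 3) ^ g.norm)) k
          rw [lintegral_const_mul _ (hm.const_mul _), lintegral_const_mul _ hm, ← mul_assoc,
            ENNReal.inv_mul_cancel hd0 hd', one_mul]
      _ ≤ ENNReal.ofReal (3 / 5) * ENNReal.ofReal ((3 / 5) ^ k) := by gcongr
      _ = _ := by rw [← ENNReal.ofReal_mul (by norm_num), pow_succ, mul_comm]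

/-- Exponential Markov inequality: on the event, `3 ^ |X_k| ≤ (4 / 3) ^ k` because `3 ≤ (4 / 3) ^
4`, and `(4 / 3) * (3 / 5) = 4 / 5`. -/
theorem measure_slow_le (hd : 4 < d) (k : ℕ) :
    incrementLaw (stdMeasure d) {ζ | 4 * (walk ζ k).norm ≤ k} ≤ ENNReal.ofReal ((4 / 5) ^ k) := by
  rw [measure_walk_eq_lintegral_ite k fun g => 4 * g.norm ≤ k]
  calc _ ≤ ∫⁻ ζ, ENNReal.ofReal ((4 / 3) ^ k) * ENNReal.ofReal ((1 / 3) ^ (walk ζ k).norm)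
          ∂(incrementLaw (stdMeasure d)) := by
        refine lintegral_mono fun ζ => ?_
        simp only
        split_ifs with h
        · rw [← ENNReal.ofReal_mul (by positivity), ← ENNReal.ofReal_one]
          refine ENNReal.ofReal_le_ofReal ?_
          have h1 : (3 : ℝ) ^ (walk ζ k).norm ≤ (4 / 3) ^ k := calc
            (3 : ℝ) ^ (walk ζ k).norm ≤ ((4 / 3) ^ 4) ^ (walk ζ k).norm := by gcongr; norm_num
            _ = (4 / 3) ^ (4 * (walk ζ k).norm) := by rw [pow_mul]
            _ ≤ (4 / 3) ^ k := pow_le_pow_right₀ (by norm_num) h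
          rw [one_div, inv_pow, ← div_eq_mul_inv, le_div_iff₀ (by positivity)]
          simpa using h1
        · exact zero_le
    _ = ENNReal.ofReal ((4 / 3) ^ k) * ∫⁻ ζ, ENNReal.ofReal ((1 / 3) ^ (walk ζ k).norm)
          ∂(incrementLaw (stdMeasure d)) :=
        lintegral_const_mul _ (measurable_comp_walk (fun g => ENNReal.ofReal ((1 / 3) ^ g.norm)) k)
    _ ≤ ENNReal.ofReal ((4 / 3) ^ k) * ENNReal.ofReal ((3 / 5) ^ k) := by
        gcongr; exact lintegral_third_pow_norm_le hd k
    _ = _ := by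
        rw [← ENNReal.ofReal_mul (by positivity), ← mul_pow]; norm_num

/-- By radial symmetry all `2d ≥ 10` letters are equally likely, and each of them contributes with
weight `1 / 3` to the mean of `3 ^ (-|X_k|)`. -/
theorem measure_walk_eq_letter_le (hd : 4 < d) (k : ℕ) (y : Fin d × Bool) :
    incrementLaw (stdMeasure d) {ζ | walk ζ k = FreeGroup.mk [y]} ≤
      ENNReal.ofReal (3 / 10 * (3 / 5) ^ k) := by
  obtain ⟨H, hH⟩ := exists_measure_walk_eq (d := d) k
  have hnorm : ∀ z : Fin d × Bool, (FreeGroup.mk [z]).norm = 1 := fun z => by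
    simpa using norm_one_mul_letter z
  have hsum : ∑ z : Fin d × Bool, incrementLaw (stdMeasure d) {ζ | walk ζ k = FreeGroup.mk [z]} ≤
      ENNReal.ofReal 3 * ENNReal.ofReal ((3 / 5) ^ k) := by
    have e : ∀ z : Fin d × Bool, incrementLaw (stdMeasure d) {ζ | walk ζ k = FreeGroup.mk [z]} =
        ∫⁻ ζ, (if walk ζ k = FreeGroup.mk [z] then 1 else 0) ∂(incrementLaw (stdMeasure d)) :=
      fun z => measure_walk_eq_lintegral_ite k fun g => g = FreeGroup.mk [z]
    simp only [e]
    rw [← lintegral_finsetSum _ fun z _ =>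
      measurable_comp_walk (fun g => if g = FreeGroup.mk [z] then 1 else 0) k]
    refine le_trans ?_ (mul_le_mul_right (lintegral_third_pow_norm_le hd k) _)
    rw [← lintegral_const_mul _
      (measurable_comp_walk (fun g => ENNReal.ofReal ((1 / 3) ^ g.norm)) k)]
    refine lintegral_mono fun ζ => ?_
    simp only
    rw [← ENNReal.ofReal_mul (by norm_num)]
    by_cases hz : ∃ z : Fin d × Bool, walk ζ k = FreeGroup.mk [z]
    · obtain ⟨z, hz⟩ := hz
      have : ∀ z' : Fin d × Bool, walk ζ k = FreeGroup.mk [z'] ↔ z' = z := fun z' => by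
        rw [hz]
        exact ⟨fun h => (mk_singleton_injective h).symm, fun h => by rw [h]⟩
      simp only [this]
      rw [hz, hnorm]
      simp
    · push Not at hz
      simp [hz]
  simp only [hH, hnorm, Finset.sum_const, nsmul_eq_mul] at hsum ⊢
  have h10 : (10 : ℝ≥0∞) * H 1 ≤ ENNReal.ofReal 3 * ENNReal.ofReal ((3 / 5) ^ k) := by
    refine le_trans (mul_le_mul_left ?_ _) hsum
    have : 10 ≤ (Finset.univ : Finset (Fin d × Bool)).card := by simp; omega
    exact_mod_cast this
  have e10 : (10 : ℝ≥0∞) = ENNReal.ofReal 10 := by simp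
  rw [ENNReal.mul_le_iff_le_inv (by norm_num) (by norm_num)] at h10
  refine h10.trans_eq ?_
  rw [e10, ← ENNReal.ofReal_inv_of_pos (by norm_num), ← ENNReal.ofReal_mul (by norm_num),
    ← ENNReal.ofReal_mul (by norm_num)]
  congr 1; ring

/-- The probability, within an event `F` about the first `n` increments, that one of at most `Q`
strings determined by the first `n` increments occurs in the increment of the walk between `n` and
some time `m ≤ N`. -/
theorem measure_exists_infix_le (hd : 4 < d) {n : ℕ} {F : Set (ℕ → FreeGroup (Fin d))}
    (hF : ∀ ζ ζ' : ℕ → FreeGroup (Fin d), (∀ i < n, ζ i = ζ' i) → ζ ∈ F → ζ' ∈ F)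
    {𝒮 : (ℕ → FreeGroup (Fin d)) → Finset (List (Fin d × Bool))}
    (h𝒮 : ∀ ζ ζ' : ℕ → FreeGroup (Fin d), (∀ i < n, ζ i = ζ' i) → 𝒮 ζ = 𝒮 ζ') {Q : ℕ}
    (hQ : ∀ ζ, (𝒮 ζ).card ≤ Q) (s N : ℕ) :
    incrementLaw (stdMeasure d) {ζ | ζ ∈ F ∧ ∃ m, n ≤ m ∧ m ≤ N ∧ ∃ S ∈ 𝒮 ζ, S.length = s ∧
      S <:+: ((walk ζ n)⁻¹ * walk ζ m).toWord} ≤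
      incrementLaw (stdMeasure d) F * ENNReal.ofReal (Q * (N + 1) ^ 2 / 9 ^ s) := by
  have hone : ∀ j ∈ Finset.range (N + 1), incrementLaw (stdMeasure d) {ζ | ζ ∈ F ∧
      (walk ζ n)⁻¹ * walk ζ (n + j) ∈ {g | ∃ S ∈ 𝒮 ζ, S.length = s ∧ S <:+: g.toWord}} ≤
      incrementLaw (stdMeasure d) F * (Q * ((N + 1) * (9 ^ s)⁻¹)) := by
    intro j hj
    refine measure_inter_le_mul (stdMeasure d) hF
      (B := fun ζ => {g | ∃ S ∈ 𝒮 ζ, S.length = s ∧ S <:+: g.toWord})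
      (fun ζ ζ' h => by simp only [h𝒮 ζ ζ' h]) fun ζ _ => ?_
    have hsub : {ζ' : ℕ → FreeGroup (Fin d) |
        walk ζ' j ∈ {g | ∃ S ∈ 𝒮 ζ, S.length = s ∧ S <:+: g.toWord}} ⊆
        ⋃ S ∈ (𝒮 ζ).filter fun S => S.length = s, {ζ' | S <:+: (walk ζ' j).toWord} := by
      rintro ζ' ⟨S, hS, hl, hi⟩
      exact Set.mem_iUnion₂.2 ⟨S, Finset.mem_filter.2 ⟨hS, hl⟩, hi⟩
    refine (measure_mono hsub).trans ((measure_biUnion_finset_le _ _).trans ?_)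
    have hS : ∀ S ∈ (𝒮 ζ).filter fun S => S.length = s,
        incrementLaw (stdMeasure d) {ζ' | S <:+: (walk ζ' j).toWord} ≤
          (N + 1) * (9 ^ s)⁻¹ := by
      intro S hS
      refine (measure_infix_le hd j S).trans ?_
      rw [(Finset.mem_filter.1 hS).2]
      gcongr
      rw [Finset.mem_range] at hj
      omega
    refine (Finset.sum_le_sum hS).trans ?_
    rw [Finset.sum_const, nsmul_eq_mul]
    gcongr
    exact (Finset.card_filter_le _ _).trans (hQ ζ)
  have hsub : {ζ : ℕ → FreeGroup (Fin d) | ζ ∈ F ∧ ∃ m, n ≤ m ∧ m ≤ N ∧ ∃ S ∈ 𝒮 ζ, S.length = s ∧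
      S <:+: ((walk ζ n)⁻¹ * walk ζ m).toWord} ⊆ ⋃ j ∈ Finset.range (N + 1), {ζ | ζ ∈ F ∧
      (walk ζ n)⁻¹ * walk ζ (n + j) ∈ {g | ∃ S ∈ 𝒮 ζ, S.length = s ∧ S <:+: g.toWord}} := by
    rintro ζ ⟨hζ, m, hnm, hm, S, hS, hl, hi⟩
    refine Set.mem_iUnion₂.2 ⟨m - n, by rw [Finset.mem_range]; omega, hζ, S, hS, hl, ?_⟩
    rwa [Nat.add_sub_cancel' hnm]
  refine (measure_mono hsub).trans ((measure_biUnion_finset_le _ _).trans ?_)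
  -- One factor `N + 1` counts the times `m`, the other the positions of the string in the
  -- increment.
  refine (Finset.sum_le_sum hone).trans_eq ?_
  rw [Finset.sum_const, Finset.card_range, nsmul_eq_mul, mul_left_comm]
  congr 1
  rw [ENNReal.ofReal_div_of_pos (by positivity), ENNReal.ofReal_mul (by positivity),
    ENNReal.ofReal_pow (by positivity), ENNReal.ofReal_pow (by positivity),
    ENNReal.ofReal_add (by positivity) (by norm_num), ENNReal.ofReal_natCast,
    ENNReal.ofReal_natCast, ENNReal.ofReal_one, ENNReal.ofReal_ofNat, ENNReal.div_eq_inv_mul]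
  push_cast
  ring

end Estimates

/-! ### Bounds for the bad events, and their summability -/

section Conclusion

open FreeGroup (invRev)

variable {d : ℕ} [IsProbabilityMeasure (stdMeasure d)]

/-- The walk starts with `M` steps `a`. -/
def startEvent (a : Fin d) (M : ℕ) : Set (ℕ → FreeGroup (Fin d)) :=
  {ζ | ∀ i < M, ζ i = FreeGroup.of a}

omit [IsProbabilityMeasure (stdMeasure d)] in
theorem mem_startEvent_of_eq {a : Fin d} {M n : ℕ} (hn : M ≤ n)
    (ζ ζ' : ℕ → FreeGroup (Fin d)) (h : ∀ i < n, ζ i = ζ' i) (hζ : ζ ∈ startEvent a M) :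
    ζ' ∈ startEvent a M := fun i hi => by rw [← h i (by omega), hζ i hi]

omit [IsProbabilityMeasure (stdMeasure d)] in
theorem walk_eq_pow {a : Fin d} {M n : ℕ} {ζ : ℕ → FreeGroup (Fin d)} (hζ : ζ ∈ startEvent a M)
    (hn : n ≤ M) : walk ζ n = FreeGroup.of a ^ n := by
  induction n with
  | zero => rfl
  | succ n ih => rw [walk, ih (by omega), hζ n (by omega), pow_succ]

theorem measure_startEvent_pos (a : Fin d) (M : ℕ) :
    0 < incrementLaw (stdMeasure d) (startEvent a M) := by
  have e : startEvent a M = Set.pi (Finset.range M) fun _ => {FreeGroup.of a} := by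
    ext ζ; simp [startEvent, Set.mem_pi]
  rw [e, incrementLaw, Measure.infinitePi_pi _ fun i _ => MeasurableSet.of_discrete]
  rw [pos_iff_ne_zero, Finset.prod_ne_zero_iff]
  intro i _
  rw [← lintegral_indicator_one MeasurableSet.of_discrete, lintegral_stdMeasure]
  refine mul_ne_zero (by simp; finiteness) ?_
  have : (1 : ℝ≥0∞) ≤ ∑ x : Fin d × Bool,
      Set.indicator {FreeGroup.of a} 1 (FreeGroup.mk [x]) := by
    refine le_trans ?_ (Finset.single_le_sum (fun _ _ => zero_le) (Finset.mem_univ (a, true)))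
    simp [FreeGroup.of]
  exact (lt_of_lt_of_le one_pos this).ne'

theorem measure_farMatch_le (hd : 4 < d) (a : Fin d) {M ℓ n : ℕ} (hn : M ≤ n) :
    incrementLaw (stdMeasure d) {ζ | ζ ∈ startEvent a M ∧ FarMatch (walk ζ) ℓ n} ≤
      incrementLaw (stdMeasure d) (startEvent a M) *
        ENNReal.ofReal ((4 * ℓ + 1) * (2 ^ (ℓ + 4) + 1) ^ 2 / 9 ^ (ℓ - 14 * (ℓ / 100))) := by
  have h := measure_exists_infix_le hd (n := n) (F := startEvent a M) (mem_startEvent_of_eq hn)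
    (𝒮 := fun ζ => ((Finset.range (4 * ℓ + 1)).filter (· ≤ n)).image
      fun k => invRev ((walk ζ k).toWord.drop (14 * (ℓ / 100)))) (by
        intro ζ ζ' h
        refine Finset.image_congr fun k hk => ?_
        simp only [Finset.coe_filter, Set.mem_ofPred_eq] at hk
        rw [walk_congr fun i hi => h i (lt_of_lt_of_le hi hk.2)])
    (Q := 4 * ℓ + 1) (fun ζ => Finset.card_image_le.trans
      ((Finset.card_filter_le _ _).trans (by simp))) (ℓ - 14 * (ℓ / 100)) (2 ^ (ℓ + 4))
  push_cast at h
  refine le_trans (measure_mono ?_) h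
  rintro ζ ⟨hζ, m, hnm, hm, k, hk, hkn, hl, hi⟩
  refine ⟨hζ, m, hnm, hm, _, Finset.mem_image.2 ⟨k, ?_, rfl⟩, ?_, hi⟩
  · rw [Finset.mem_filter, Finset.mem_range]; omega
  · simp only [FreeGroup.norm] at hl
    simp [hl]

theorem measure_nearMatch_le (hd : 4 < d) (a : Fin d) (M ℓ : ℕ) :
    incrementLaw (stdMeasure d) {ζ | ζ ∈ startEvent a M ∧ NearMatch (walk ζ) M ℓ} ≤
      incrementLaw (stdMeasure d) (startEvent a M) *
        ENNReal.ofReal ((20 * ℓ + 1) * ((20 * ℓ + 1) ^ 2 * (20 * ℓ + 1) ^ 2 / 9 ^ (ℓ / 100))) := by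
  have h : ∀ n ∈ Finset.Icc M (20 * ℓ), _ := fun n hn =>
    measure_exists_infix_le hd (n := n) (F := startEvent a M)
      (mem_startEvent_of_eq (Finset.mem_Icc.1 hn).1)
    (𝒮 := fun ζ => (Finset.range (n + 1) ×ˢ Finset.range (20 * ℓ + 1)).image
      -- The candidate strings are indexed by an earlier time `p.1` and a starting position `p.2`.
      fun p => invRev (((walk ζ p.1).toWord.drop p.2).take (ℓ / 100))) (by
        intro ζ ζ' h
        refine Finset.image_congr fun p hp => ?_
        simp only [Finset.coe_product, Set.mem_prod, Finset.coe_range, Set.mem_Iio] at hp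
        rw [walk_congr fun i hi => h i (by omega)])
    (Q := (20 * ℓ + 1) ^ 2) (fun ζ => Finset.card_image_le.trans (by
      rw [Finset.card_product, Finset.card_range, Finset.card_range, sq]
      have := (Finset.mem_Icc.1 hn).2
      gcongr)) (ℓ / 100) (20 * ℓ)
  have hsub : {ζ : ℕ → FreeGroup (Fin d) | ζ ∈ startEvent a M ∧ NearMatch (walk ζ) M ℓ}
      ≤ᵐ[incrementLaw (stdMeasure d)] ⋃ n ∈ Finset.Icc M (20 * ℓ), {ζ | ζ ∈ startEvent a M ∧
        ∃ m, n ≤ m ∧ m ≤ 20 * ℓ ∧ ∃ S ∈ (Finset.range (n + 1) ×ˢ Finset.range (20 * ℓ + 1)).image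
          (fun p => invRev (((walk ζ p.1).toWord.drop p.2).take (ℓ / 100))),
          S.length = ℓ / 100 ∧ S <:+: ((walk ζ n)⁻¹ * walk ζ m).toWord} := by
    filter_upwards [ae_mem_standardGenerators (d := d)] with ζ hpath hζ
    obtain ⟨hζ, n, m, hMn, hnm, hm, k, hk, S, hS, ⟨p, q, e⟩, hi⟩ :=
      (hζ : ζ ∈ startEvent a M ∧ NearMatch (walk ζ) M ℓ)
    refine Set.mem_iUnion₂.2 ⟨n, Finset.mem_Icc.2 ⟨hMn, by omega⟩, hζ, m, hnm, hm, S,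
      Finset.mem_image.2 ⟨(k, p.length), ?_, ?_⟩, hS, hi⟩
    · have := (isPath_walk hpath).norm_le k
      rw [FreeGroup.norm, ← e] at this
      simp at this
      rw [Finset.mem_product, Finset.mem_range, Finset.mem_range]
      simp only
      omega
    · simp only
      rw [← e, List.append_assoc, List.drop_left, List.take_append_of_le_length (by simp [hS]),
        List.take_of_length_le (by simp [hS]), FreeGroup.invRev_invRev]
  refine (measure_mono_ae hsub).trans ((measure_biUnion_finset_le _ _).trans ?_)
  refine (Finset.sum_le_sum h).trans ?_
  rw [Finset.sum_const, nsmul_eq_mul, mul_left_comm]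
  gcongr
  rw [ENNReal.ofReal_mul (by positivity)]
  refine mul_le_mul' ?_ (le_of_eq (by push_cast; rfl))
  · rw [← ENNReal.ofReal_natCast]
    apply ENNReal.ofReal_le_ofReal
    rw [Nat.card_Icc]
    have : 20 * ℓ + 1 - M ≤ 20 * ℓ + 1 := Nat.sub_le _ _
    exact_mod_cast this

theorem measure_lowMatch_le (hd : 4 < d) (a : Fin d) {M ℓ n : ℕ} (hn : M ≤ n) (hℓ : 1 ≤ ℓ)
    (hn' : 8 * (ℓ / 100) ≤ n) (hlog : 2 * ℓ < 2 ^ (ℓ / 100)) :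
    incrementLaw (stdMeasure d) {ζ | ζ ∈ startEvent a M ∧ LowMatch (walk ζ) ℓ n} ≤
      incrementLaw (stdMeasure d) (startEvent a M) *
        ENNReal.ofReal ((2 * ℓ) ^ 2 * 8 ^ (ℓ / 100) * (4 * ℓ + 1) ^ 2 / 9 ^ (ℓ / 100)) := by
  have hlt : Nat.log 2 (2 * ℓ) < ℓ / 100 := Nat.log_lt_of_lt_pow (by omega) hlog
  have h := measure_exists_infix_le hd (n := n) (F := startEvent a M) (mem_startEvent_of_eq hn)
    (𝒮 := fun ζ => (chainStrings (walk ζ) (ℓ / 100) (2 * ℓ)).image invRev) (by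
        intro ζ ζ' h
        rw [chainStrings_congr (Y := walk ζ')]
        exact fun t ht => walk_congr fun i hi => h i (by omega))
    (Q := (2 * ℓ) ^ 2 * 8 ^ (ℓ / 100)) (fun ζ => Finset.card_image_le.trans
      (card_chainStrings_le _ _ (by omega))) (ℓ / 100) (4 * ℓ)
  push_cast at h
  refine le_trans (measure_mono ?_) h
  rintro ζ ⟨hζ, m, hnm, hm, S, hS, hl, hi⟩
  exact ⟨hζ, m, hnm, hm, _, Finset.mem_image_of_mem _ hS, by simpa using hl, hi⟩

/-- The sum of the three error probabilities at scale `ℓ`. -/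
noncomputable def matchError (ℓ : ℕ) : ℝ :=
  (4 * ℓ + 1) * (2 ^ (ℓ + 4) + 1) ^ 2 / 9 ^ (ℓ - 14 * (ℓ / 100)) +
    ((20 * ℓ + 1) * ((20 * ℓ + 1) ^ 2 * (20 * ℓ + 1) ^ 2 / 9 ^ (ℓ / 100)) +
      (2 * ℓ) ^ 2 * 8 ^ (ℓ / 100) * (4 * ℓ + 1) ^ 2 / 9 ^ (ℓ / 100))

theorem matchError_nonneg (ℓ : ℕ) : 0 ≤ matchError ℓ := by unfold matchError; positivity

/-- Since `8 / 9 ≤ 0.999 ^ 100`; rounding `ℓ / 100` down loses at most `99` factors `0.999`,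
absorbed by the constant `2`. -/
theorem eight_div_nine_pow_le (ℓ : ℕ) : (8 / 9 : ℝ) ^ (ℓ / 100) ≤ 2 * (999 / 1000) ^ ℓ := by
  have h1 : (8 / 9 : ℝ) ^ (ℓ / 100) ≤ (999 / 1000) ^ (100 * (ℓ / 100)) := by
    rw [pow_mul]
    gcongr
    norm_num
  have h2 : (999 / 1000 : ℝ) ^ (100 * (ℓ / 100) + 99) ≤ (999 / 1000) ^ ℓ :=
    pow_le_pow_of_le_one (by norm_num) (by norm_num) (by omega)
  rw [pow_add] at h2
  have h3 : (1 / 2 : ℝ) ≤ (999 / 1000) ^ 99 := by norm_num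
  have h4 : (0 : ℝ) < (999 / 1000) ^ (100 * (ℓ / 100)) := by positivity
  nlinarith

theorem matchError_le (ℓ : ℕ) :
    matchError ℓ ≤ 10000000 * (((ℓ + 1 : ℕ) : ℝ) ^ 5 * (999 / 1000) ^ ℓ) := by
  have hK := eight_div_nine_pow_le ℓ
  set K := ℓ / 100 with hKdef
  set r : ℝ := (999 / 1000) ^ ℓ with hr
  have hr0 : 0 < r := by positivity
  have hL : (1 : ℝ) ≤ ((ℓ + 1 : ℕ) : ℝ) := by norm_cast; omega
  have hL' : ((ℓ + 1 : ℕ) : ℝ) = ℓ + 1 := by push_cast; rfl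
  set L : ℝ := ((ℓ + 1 : ℕ) : ℝ)
  have hℓ0 : (0 : ℝ) ≤ ℓ := by positivity
  have hL5 : L ^ 4 ≤ L ^ 5 := pow_le_pow_right₀ hL (by norm_num)
  have hL1 : L ≤ L ^ 5 := by simpa using pow_le_pow_right₀ hL (show 1 ≤ 5 by norm_num)
  have t1 : (4 * ℓ + 1) * (2 ^ (ℓ + 4) + 1) ^ 2 / 9 ^ (ℓ - 14 * K) ≤ 4096 * (L ^ 5 * r) := by
    have h14 : 14 * K ≤ ℓ := by omega
    have hsplit : (9 : ℝ) ^ ℓ = 9 ^ (ℓ - 14 * K) * 9 ^ (14 * K) := by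
      rw [← pow_add, Nat.sub_add_cancel h14]
    have h9 : (9 : ℝ) ^ (14 * K) ≤ (3 / 2) ^ ℓ := calc
      (9 : ℝ) ^ (14 * K) = (9 ^ 14) ^ K := by rw [pow_mul]
      _ ≤ ((3 / 2) ^ 100) ^ K := by gcongr; norm_num
      _ = (3 / 2) ^ (100 * K) := by rw [pow_mul]
      _ ≤ (3 / 2) ^ ℓ := pow_le_pow_right₀ (by norm_num) (by omega)
    have h2 : ((2 : ℝ) ^ (ℓ + 4) + 1) ^ 2 ≤ 1024 * 4 ^ ℓ := by
      have h1 : (1 : ℝ) ≤ 2 ^ (ℓ + 4) := one_le_pow₀ (by norm_num)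
      calc ((2 : ℝ) ^ (ℓ + 4) + 1) ^ 2 ≤ (2 ^ (ℓ + 4) + 2 ^ (ℓ + 4)) ^ 2 := by gcongr
        _ = 1024 * (2 ^ 2) ^ ℓ := by rw [← pow_mul]; ring
        _ = 1024 * 4 ^ ℓ := by norm_num
    rw [div_le_iff₀ (by positivity)]
    have hmain : (4 : ℝ) ^ ℓ ≤ r * 9 ^ (ℓ - 14 * K) := by
      have h3 : (4 : ℝ) ^ ℓ * 9 ^ (14 * K) ≤ r * 9 ^ ℓ := by
        calc (4 : ℝ) ^ ℓ * 9 ^ (14 * K) ≤ 4 ^ ℓ * (3 / 2) ^ ℓ := by gcongr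
          _ = 6 ^ ℓ := by rw [← mul_pow]; norm_num
          _ ≤ (999 / 1000 * 9) ^ ℓ := by gcongr; norm_num
          _ = r * 9 ^ ℓ := by rw [mul_pow]
      rw [hsplit, ← mul_assoc] at h3
      exact le_of_mul_le_mul_right h3 (by positivity)
    calc (4 * (ℓ : ℝ) + 1) * (2 ^ (ℓ + 4) + 1) ^ 2 ≤ (4 * L) * (1024 * (r * 9 ^ (ℓ - 14 * K))) := by
          gcongr
          · linarith
          · linarith
      _ = 4096 * (L * r) * 9 ^ (ℓ - 14 * K) := by ring
      _ ≤ 4096 * (L ^ 5 * r) * 9 ^ (ℓ - 14 * K) := by gcongr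
  have h89 : (8 : ℝ) ^ K / 9 ^ K ≤ 2 * r := by rw [← div_pow]; exact hK
  have h19 : 1 / (9 : ℝ) ^ K ≤ 2 * r := by
    refine le_trans ?_ h89
    gcongr
    exact one_le_pow₀ (by norm_num)
  have t2 : (20 * ℓ + 1) * ((20 * ℓ + 1) ^ 2 * (20 * ℓ + 1) ^ 2 / 9 ^ K) ≤ 6400000 * (L ^ 5 * r) := by
    have hb : (20 * ℓ + 1 : ℝ) ≤ 20 * L := by linarith
    calc (20 * (ℓ : ℝ) + 1) * ((20 * ℓ + 1) ^ 2 * (20 * ℓ + 1) ^ 2 / 9 ^ K)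
        = (20 * ℓ + 1) ^ 5 * (1 / 9 ^ K) := by ring
      _ ≤ (20 * L) ^ 5 * (2 * r) := by gcongr
      _ = _ := by ring
  have t3 : (2 * ℓ) ^ 2 * 8 ^ K * (4 * ℓ + 1) ^ 2 / 9 ^ K ≤ 128 * (L ^ 5 * r) := by
    calc (2 * (ℓ : ℝ)) ^ 2 * 8 ^ K * (4 * ℓ + 1) ^ 2 / 9 ^ K
        = (2 * ℓ) ^ 2 * (4 * ℓ + 1) ^ 2 * (8 ^ K / 9 ^ K) := by ring
      _ ≤ (2 * L) ^ 2 * (4 * L) ^ 2 * (2 * r) := by gcongr <;> linarith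
      _ = 128 * (L ^ 4 * r) := by ring
      _ ≤ 128 * (L ^ 5 * r) := by gcongr
  have h0 : 0 ≤ L ^ 5 * r := by positivity
  unfold matchError
  linarith

theorem summable_matchError : Summable matchError := by
  refine Summable.of_nonneg_of_le matchError_nonneg matchError_le (Summable.mul_left _ ?_)
  have h := (summable_nat_add_iff 1).2
    (summable_pow_mul_geometric_of_norm_lt_one 5 (r := (999 / 1000 : ℝ)) (by norm_num))
  refine (h.mul_left (1000 / 999)).congr fun n => ?_
  rw [pow_succ]
  ring

theorem two_mul_lt_two_pow_div {ℓ : ℕ} (h : 1200 ≤ ℓ) : 2 * ℓ < 2 ^ (ℓ / 100) := by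
  have key : ∀ K, 12 ≤ K → 200 * K + 198 < 2 ^ K := by
    intro K hK
    induction K, hK using Nat.le_induction with
    | base => norm_num
    | succ K hK ih => rw [pow_succ]; omega
  have := key (ℓ / 100) (by omega)
  omega

omit [IsProbabilityMeasure (stdMeasure d)] in
theorem goodPath_of_not_bad {a : Fin d} {M ℓ₀ : ℕ} (hM : M = 2 ^ (ℓ₀ + 2))
    {ζ : ℕ → FreeGroup (Fin d)} (hgen : ∀ i, ζ i ∈ standardGenerators d) (hζ : ζ ∈ startEvent a M)
    (hstay : ∀ j, (walk ζ M)⁻¹ * walk ζ (M + j) ≠ FreeGroup.mk [(a, false)])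
    (hspeed : ∀ j, ¬ 4 * ((walk ζ M)⁻¹ * walk ζ (M + (j + 24))).norm ≤ j + 24)
    (hfar : ∀ j, ¬ FarMatch (walk ζ) (j + ℓ₀) (max (4 * (j + ℓ₀)) M))
    (hnear : ∀ j, ¬ NearMatch (walk ζ) M (j + ℓ₀))
    (hlow : ∀ j, ¬ LowMatch (walk ζ) (j + ℓ₀) (max (8 * ((j + ℓ₀) / 100)) M))
    (hM24 : 24 ≤ 3 * M) : GoodPath (walk ζ) a M := by
  have hpath := isPath_walk hgen
  have hstay' : ∀ n, M ≤ n → (walk ζ M)⁻¹ * walk ζ n ≠ (FreeGroup.of a)⁻¹ := by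
    intro n hn h
    apply hstay (n - M)
    rw [Nat.add_sub_cancel' hn, h]
    rfl
  have hle : ∀ ℓ, M ≤ 4 * ℓ → ℓ₀ ≤ ℓ := by
    intro ℓ h
    have h1 : 2 ^ (ℓ₀ + 2) = 4 * 2 ^ ℓ₀ := by ring
    have := Nat.lt_two_pow_self (n := ℓ₀)
    omega
  refine ⟨hpath, fun n hn => walk_eq_pow hζ hn, hstay', fun n => ?_, fun ℓ hℓ => ?_,
    fun ℓ hℓ => ?_, fun ℓ hℓ => ?_⟩
  -- Escape after the prefix is only assumed from `24` further steps on; before that the prefix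
  -- alone gives `n < M + 24 ≤ 4 * M`.
  · rcases le_total n M with hn | hn
    · rw [walk_eq_pow hζ hn, FreeGroup.norm_of_pow]; omega
    · have h := hpath.toWord_eq_replicate_append (walk_eq_pow hζ le_rfl) hstay' hn
      have hnorm : (walk ζ n).norm = M + ((walk ζ M)⁻¹ * walk ζ n).norm := by
        rw [FreeGroup.norm, h]; simp [FreeGroup.norm]
      rcases lt_or_ge n (M + 24) with h24 | h24
      · omega
      · have := hspeed (n - M - 24)
        rw [show M + (n - M - 24 + 24) = n by omega] at this
        omega
  · have : ℓ₀ + 2 < ℓ + 1 := by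
      rw [hM] at hℓ
      exact (Nat.pow_lt_pow_iff_right (by norm_num)).1 hℓ
    have h := hfar (ℓ - ℓ₀)
    rwa [Nat.sub_add_cancel (by omega)] at h
  · have h := hnear (ℓ - ℓ₀)
    rwa [Nat.sub_add_cancel (hle ℓ hℓ)] at h
  · have h := hlow (ℓ - ℓ₀)
    rwa [Nat.sub_add_cancel (hle ℓ hℓ)] at h

end Conclusion

/-! ### Good paths have positive probability, and the theorem -/

section Main

open Filter in
/-- The total error probability is less than `1`. -/
theorem exists_tsum_error_lt_one : ∃ ℓ₀ : ℕ, 1200 ≤ ℓ₀ ∧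
    Summable (fun j : ℕ => 3 / 10 * (3 / 5 : ℝ) ^ j + ((4 / 5) ^ (j + 24) + matchError (j + ℓ₀))) ∧
    ∑' j : ℕ, (3 / 10 * (3 / 5 : ℝ) ^ j + ((4 / 5) ^ (j + 24) + matchError (j + ℓ₀))) < 1 := by
  have ht := tendsto_sum_nat_add matchError
  obtain ⟨ℓ₀, h1, h2⟩ := ((ht.eventually_lt_const (show (0 : ℝ) < 1 / 10 by norm_num)).and
    (eventually_ge_atTop 1200)).exists
  have s1 : HasSum (fun j : ℕ => 3 / 10 * (3 / 5 : ℝ) ^ j) (3 / 10 * (1 - 3 / 5)⁻¹) :=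
    (hasSum_geometric_of_lt_one (by norm_num) (by norm_num)).mul_left _
  have s2 : HasSum (fun j : ℕ => (4 / 5 : ℝ) ^ (j + 24)) ((1 - 4 / 5)⁻¹ * (4 / 5) ^ 24) := by
    simp only [pow_add]
    exact (hasSum_geometric_of_lt_one (by norm_num) (by norm_num)).mul_right _
  have s3 : Summable fun j => matchError (j + ℓ₀) := (summable_nat_add_iff ℓ₀).2 summable_matchError
  refine ⟨ℓ₀, h2, s1.summable.add (s2.summable.add s3), ?_⟩
  rw [s1.summable.tsum_add (s2.summable.add s3), s2.summable.tsum_add s3, s1.tsum_eq, s2.tsum_eq]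
  -- Backtracking costs `3 / 4`; the delay `24` makes the cost of slow escape small enough to leave
  -- `1 / 10` for the coincidences.
  have : (3 / 10 * (1 - 3 / 5)⁻¹ : ℝ) + (1 - 4 / 5)⁻¹ * (4 / 5) ^ 24 < 9 / 10 := by norm_num
  linarith

variable {d : ℕ} [IsProbabilityMeasure (stdMeasure d)]

/-- With positive probability the walk follows a good path. -/
theorem exists_measure_goodPath_pos (hd : 4 < d) (a : Fin d) : ∃ M : ℕ, 8 ≤ M ∧
    (∀ ℓ, M ≤ 4 * ℓ → 100 ≤ ℓ ∧ 2 * ℓ < 2 ^ (ℓ / 100)) ∧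
    0 < incrementLaw (stdMeasure d) {ζ | GoodPath (walk ζ) a M} := by
  obtain ⟨ℓ₀, hℓ₀, hsum, hlt⟩ := exists_tsum_error_lt_one
  -- With this `M`, both `M < 2 ^ (ℓ + 1)` and `M ≤ 4 * ℓ` force `ℓ ≥ ℓ₀`, so only the tail of the
  -- error series matters.
  obtain ⟨M, hM⟩ : ∃ M, M = 2 ^ (ℓ₀ + 2) := ⟨_, rfl⟩
  have hM' : 4 * ℓ₀ < M := by
    have h1 : 2 ^ (ℓ₀ + 2) = 4 * 2 ^ ℓ₀ := by ring
    have := Nat.lt_two_pow_self (n := ℓ₀)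
    omega
  refine ⟨M, by omega, fun ℓ hℓ => ⟨by omega, two_mul_lt_two_pow_div (by omega)⟩, ?_⟩
  set P := incrementLaw (stdMeasure d)
  set F := startEvent a M
  set T := {ζ : ℕ → FreeGroup (Fin d) | GoodPath (walk ζ) a M}
  let B₁ (j : ℕ) : Set (ℕ → FreeGroup (Fin d)) :=
    {ζ | ζ ∈ F ∧ (walk ζ M)⁻¹ * walk ζ (M + j) ∈ ({FreeGroup.mk [(a, false)]} : Set _)}
  let B₂ (j : ℕ) : Set (ℕ → FreeGroup (Fin d)) :=
    {ζ | ζ ∈ F ∧ (walk ζ M)⁻¹ * walk ζ (M + (j + 24)) ∈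
      {g : FreeGroup (Fin d) | 4 * g.norm ≤ j + 24}}
  let B₃ (j : ℕ) : Set (ℕ → FreeGroup (Fin d)) :=
    {ζ | ζ ∈ F ∧ FarMatch (walk ζ) (j + ℓ₀) (max (4 * (j + ℓ₀)) M)}
  let B₄ (j : ℕ) : Set (ℕ → FreeGroup (Fin d)) := {ζ | ζ ∈ F ∧ NearMatch (walk ζ) M (j + ℓ₀)}
  let B₅ (j : ℕ) : Set (ℕ → FreeGroup (Fin d)) :=
    {ζ | ζ ∈ F ∧ LowMatch (walk ζ) (j + ℓ₀) (max (8 * ((j + ℓ₀) / 100)) M)}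
  have hB : ∀ j, P (B₁ j ∪ (B₂ j ∪ (B₃ j ∪ (B₄ j ∪ B₅ j)))) ≤
      P F * ENNReal.ofReal (3 / 10 * (3 / 5 : ℝ) ^ j +
        ((4 / 5) ^ (j + 24) + matchError (j + ℓ₀))) := by
    intro j
    have h1 : P (B₁ j) ≤ P F * ENNReal.ofReal (3 / 10 * (3 / 5 : ℝ) ^ j) :=
      measure_inter_le_mul (stdMeasure d) (mem_startEvent_of_eq le_rfl)
        (fun _ _ _ => rfl) fun ζ _ => measure_walk_eq_letter_le hd j (a, false)
    have h2 : P (B₂ j) ≤ P F * ENNReal.ofReal ((4 / 5) ^ (j + 24)) :=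
      measure_inter_le_mul (stdMeasure d) (mem_startEvent_of_eq le_rfl)
        (B := fun _ => {g : FreeGroup (Fin d) | 4 * g.norm ≤ j + 24})
        (fun _ _ _ => rfl) fun ζ _ => measure_slow_le hd (j + 24)
    have h3 := measure_farMatch_le hd a (ℓ := j + ℓ₀) (le_max_right (4 * (j + ℓ₀)) M)
    have h4 := measure_nearMatch_le hd a M (j + ℓ₀)
    have h5 := measure_lowMatch_le hd a (ℓ := j + ℓ₀) (le_max_right (8 * ((j + ℓ₀) / 100)) M)
      (by omega) (le_max_left _ _) (two_mul_lt_two_pow_div (by omega))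
    rw [ENNReal.ofReal_add (by positivity) (add_nonneg (by positivity) (matchError_nonneg _)),
      ENNReal.ofReal_add (by positivity) (matchError_nonneg _), matchError,
      ENNReal.ofReal_add (by positivity) (by positivity),
      ENNReal.ofReal_add (by positivity) (by positivity), mul_add, mul_add, mul_add, mul_add]
    exact (measure_union_le _ _).trans (add_le_add h1 ((measure_union_le _ _).trans
      (add_le_add h2 ((measure_union_le _ _).trans (add_le_add h3 ((measure_union_le _ _).trans
        (add_le_add h4 h5)))))))
  have hcover : F ≤ᵐ[P]
      (T ∪ ⋃ j, (B₁ j ∪ (B₂ j ∪ (B₃ j ∪ (B₄ j ∪ B₅ j)))) : Set (ℕ → FreeGroup (Fin d))) := by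
    filter_upwards [ae_mem_standardGenerators (d := d)] with ζ hgen hζ
    by_contra hcon
    have hcon' : ζ ∉ T ∪ ⋃ j, (B₁ j ∪ (B₂ j ∪ (B₃ j ∪ (B₄ j ∪ B₅ j)))) := hcon
    rw [Set.mem_union, not_or, Set.mem_iUnion, not_exists] at hcon'
    obtain ⟨hT, hj⟩ := hcon'
    simp only [Set.mem_union, not_or] at hj
    have hζ' : ζ ∈ F := hζ
    exact hT (goodPath_of_not_bad hM hgen hζ'
      (fun j h => (hj j).1 ⟨hζ', h⟩)
      (fun j h => (hj j).2.1 ⟨hζ', h⟩)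
      (fun j h => (hj j).2.2.1 ⟨hζ', h⟩)
      (fun j h => (hj j).2.2.2.1 ⟨hζ', h⟩)
      (fun j h => (hj j).2.2.2.2 ⟨hζ', h⟩) (by omega))
  have hF : 0 < P F := measure_startEvent_pos a M
  rw [pos_iff_ne_zero]
  intro hT
  -- If good paths were null, the bad events would cover `F` up to a null set, although their total
  -- mass is less than `P F`. Only monotonicity and subadditivity are applied to these sets, so
  -- their measurability is not needed here.
  have hPF : P F ≤ P F * ENNReal.ofReal (∑' j : ℕ, (3 / 10 * (3 / 5 : ℝ) ^ j +
      ((4 / 5) ^ (j + 24) + matchError (j + ℓ₀)))) := by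
    calc P F ≤ P (T ∪ ⋃ j, (B₁ j ∪ (B₂ j ∪ (B₃ j ∪ (B₄ j ∪ B₅ j))))) := measure_mono_ae hcover
      _ ≤ P T + P (⋃ j, (B₁ j ∪ (B₂ j ∪ (B₃ j ∪ (B₄ j ∪ B₅ j))))) := measure_union_le _ _
      _ = P (⋃ j, (B₁ j ∪ (B₂ j ∪ (B₃ j ∪ (B₄ j ∪ B₅ j))))) := by rw [hT, zero_add]
      _ ≤ ∑' j, P (B₁ j ∪ (B₂ j ∪ (B₃ j ∪ (B₄ j ∪ B₅ j)))) := measure_iUnion_le _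
      _ ≤ ∑' j, P F * ENNReal.ofReal (3 / 10 * (3 / 5 : ℝ) ^ j +
            ((4 / 5) ^ (j + 24) + matchError (j + ℓ₀))) := ENNReal.tsum_le_tsum hB
      _ = _ := by
        rw [ENNReal.tsum_mul_left, ENNReal.ofReal_tsum_of_nonneg _ hsum]
        exact fun j => add_nonneg (by positivity) (add_nonneg (by positivity) (matchError_nonneg _))
  refine absurd hPF (not_le.2 ?_)
  calc P F * _ < P F * 1 := by
        refine ENNReal.mul_lt_mul_right hF.ne' (measure_ne_top _ _) ?_
        rw [← ENNReal.ofReal_one]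
        exact (ENNReal.ofReal_lt_ofReal_iff one_pos).2 hlt
    _ = P F := mul_one _

end Main

end AlgRec

theorem theorem3p1 (d : ℕ) (hd : 4 < d) :
    ¬ AlgRec.IsAR (AlgRec.stdMeasure d) ∧
    ∃ n₀ : ℕ, 1 ≤ n₀ ∧
      0 < AlgRec.incrementLaw (AlgRec.stdMeasure d)
        {ζ : ℕ → FreeGroup (Fin d) |
          (AlgRec.tailSemigroup (AlgRec.walk ζ) n₀ : Set (FreeGroup (Fin d))) ⊆
              AlgRec.allOverlapWords (AlgRec.walk ζ) ∧
            AlgRec.allOverlapWords (AlgRec.walk ζ) ≠ Set.univ} := by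
  have := AlgRec.isProbabilityMeasure_stdMeasure (d := d) (by omega)
  obtain ⟨M, hM, hlarge, hpos⟩ := AlgRec.exists_measure_goodPath_pos hd ⟨0, by omega⟩
  have hmain : 0 < AlgRec.incrementLaw (AlgRec.stdMeasure d)
      {ζ : ℕ → FreeGroup (Fin d) |
        (AlgRec.tailSemigroup (AlgRec.walk ζ) M : Set (FreeGroup (Fin d))) ⊆
            AlgRec.allOverlapWords (AlgRec.walk ζ) ∧
          AlgRec.allOverlapWords (AlgRec.walk ζ) ≠ Set.univ} := by
    refine hpos.trans_le (measure_mono fun ζ hζ => ?_)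
    exact ⟨AlgRec.GoodPath.tailSemigroup_subset hζ hM hlarge,
      AlgRec.GoodPath.allOverlapWords_ne_univ hζ (by omega)⟩
  refine ⟨fun hAR => hmain.ne' ?_, M, by omega, hmain⟩
  refine measure_mono_null ?_ (ae_iff.1 (hAR M (by omega)))
  rintro ζ ⟨h1, h2⟩ h3
  rw [h3] at h1
  exact h2 (Set.univ_subset_iff.1 h1)
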